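/- Let $\pi$ be a set of primes, let $\pi'$ be the set of all primes not in $\pi$, and let $G$ be a finite $\pi$-separable group. Subgroups $A,B$ of a group are permutable if $AB=BA$. Let $\sigma^{\pi}=\{\pi,\pi'\}$; a subgroup $A$ of a finite group $X$ is called $\sigma^{\pi}$-permutable in $X$ if $X$ possesses a complete Hall $\sigma^{\pi}$-set and $A$ permutes with every Hall $\pi$-subgroup and with every Hall $\pi'$-subgroup of $X$. Here a complete Hall $\sigma^{\pi}$-set of $X$ is a set $\mathcal H$ of subgroups of $X$ such that every member $\neq 1$ of $\mathcal H$ is a Hall $\pi$-subgroup or a Hall $\pi'$-subgroup of $X$, and, for each $\tau\in\{\pi,\pi'\}$ containing a prime divisor of $|X|$, $\mathcal H$ contains exactly one Hall $\tau$-subgroup of $X$. (Every finite $\pi$-separable group possesses such a set.) Let $\mathcal L$ be the lattice of all $\sigma^{\pi}$-permutable subgroups of $G$, ordered by inclusion, and let $D$ be the $\pi$-decomposable residual of $G$, that is, the smallest normal subgroup of $G$ such that $G/D$ is $\pi$-decomposable, where a finite group $X$ is $\pi$-decomposable if $X=O_{\pi}(X)\times O_{\pi'}(X)$. Then the lattice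 $\mathcal L$ is distributive if and only if the following conditions hold. 1. (i) Every two members of $\mathcal L$ are permutable; (ii) the lattice $\mathcal L_n(G)$ of all normal subgroups of $G$ is distributive; (iii) $G/D$ is cyclic, and $D$ is a meet-distributive element of $\mathcal L$, that is, $D\in\mathcal L$ and $D\wedge(B\vee C)=(D\wedge B)\vee(D\wedge C)$ for all $B,C\in\mathcal L$. 2. In every factor group $\bar G=G/R$, any two $O^{\pi}(\bar G)$-isomorphic sections $\bar H/\bar K$ and $\bar L/\bar K$, where $\bar K,\bar H,\bar L$ are $\sigma^{\pi}$-permutable $\pi$-subgroups of $\bar G$, coincide. 3. In every factor group $\bar G=G/R$, any two $O^{\pi'}(\bar G)$-isomorphic sections $\bar H/\bar K$ and $\bar L/\bar K$, where $\bar K,\bar H,\bar L$ are $\sigma^{\pi}$-permutable $\pi'$-subgroups of $\bar G$, coincide. Here, for $\tau\in\{\pi,\pi'\}$, $O_{\tau}(X)$ is the largest normal $\tau$-subgroup of $X$ and $O^{\tau}(X)$ is the smallest normal subgroup of $X$ whose quotient is a $\tau$-group. A section $\bar H/\bar K$ is given by subgroups $\bar K\trianglelefteq\bar H$. If $\bar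 K\trianglelefteq\bar H$ are $\sigma^{\pi}$-permutable $\tau$-subgroups of $\bar G$, then $O^{\tau}(\bar G)$ normalizes both of them and acts on $\bar H/\bar K$ by $(h\bar K)^{a}=(a^{-1}ha)\bar K$; $O^{\tau}(\bar G)$-isomorphic means that there is a group isomorphism commuting with these actions. -/

import Mathlib

open scoped Pointwise

namespace SigmaPerm

/-! ### `π`-numbers, `π`-groups, Hall subgroups

A set of primes is a term of `Set Nat.Primes`, so that the complement `πᶜ` is the set `π'` of all
primes outside `π`. All groups to which these notions are applied are finite. -/

/-- `n` is a `π`-number: all its prime divisors lie in `π`. -/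
def IsPiNumber (π : Set Nat.Primes) (n : ℕ) : Prop :=
  ∀ p : Nat.Primes, (p : ℕ) ∣ n → p ∈ π

/-- `G` is a `π`-group: its order is a `π`-number. -/
def IsPiGroup (π : Set Nat.Primes) (G : Type*) [Group G] : Prop :=
  IsPiNumber π (Nat.card G)

/-- `H` is a Hall `π`-subgroup of `G`: a `π`-subgroup whose index is a `π'`-number. -/
def IsHall (π : Set Nat.Primes) {G : Type*} [Group G] (H : Subgroup G) : Prop :=
  IsPiGroup π H ∧ IsPiNumber πᶜ H.index

/-- `O_π(G)`: the subgroup generated by all normal `π`-subgroups, that is, the largest normal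
`π`-subgroup of the finite group `G`. -/
def piCore (π : Set Nat.Primes) (G : Type*) [Group G] : Subgroup G :=
  sSup {N : Subgroup G | N.Normal ∧ IsPiGroup π N}

/-- `O^π(G)`: the intersection of all normal subgroups with `π`-quotient, that is, the smallest
normal subgroup of the finite group `G` whose quotient is a `π`-group. -/
def piResidual (π : Set Nat.Primes) (G : Type*) [Group G] : Subgroup G :=
  sInf {N : Subgroup G | ∃ _ : N.Normal, IsPiGroup π (G ⧸ N)}

/-- `G` is `π`-separable: it has a normal series `1 = G_0 ≤ G_1 ≤ ⋯ ≤ G_n = G` each of whose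
factors is a `π`-group or a `π'`-group. -/
def IsPiSeparable (π : Set Nat.Primes) (G : Type*) [Group G] : Prop :=
  ∃ (n : ℕ) (s : ℕ → Subgroup G), s 0 = ⊥ ∧ s n = ⊤ ∧ (∀ i, (s i).Normal) ∧
    ∀ i < n, s i ≤ s (i + 1) ∧
      (IsPiNumber π ((s i).relIndex (s (i + 1))) ∨ IsPiNumber πᶜ ((s i).relIndex (s (i + 1))))

/-- `G` is `π`-decomposable: `G = O_π(G) × O_π'(G)` (internal direct product; the two factors
are normal, so it is enough that they are complementary). -/
def IsPiDecomposable (π : Set Nat.Primes) (G : Type*) [Group G] : Prop :=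
  IsCompl (piCore π G) (piCore πᶜ G)

/-- The `π`-decomposable residual of `G`: the intersection of all normal subgroups with
`π`-decomposable quotient, that is, the smallest such normal subgroup of the finite group `G`. -/
def piDecomposableResidual (π : Set Nat.Primes) (G : Type*) [Group G] : Subgroup G :=
  sInf {N : Subgroup G | ∃ _ : N.Normal, IsPiDecomposable π (G ⧸ N)}

instance piDecomposableResidual_normal (π : Set Nat.Primes) (G : Type*) [Group G] :
    (piDecomposableResidual π G).Normal := by
  refine ⟨fun x hx g => ?_⟩
  unfold piDecomposableResidual at hx ⊢
  rw [Subgroup.mem_sInf] at hx ⊢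
  rintro N ⟨hN, hd⟩
  exact hN.conj_mem x (hx N ⟨hN, hd⟩) g

/-! ### `σ`-permutable subgroups -/

/-- The partition `σ^π = {π, π'}` of the set of all primes. -/
def sigmaPi (π : Set Nat.Primes) : Bool → Set Nat.Primes
  | true => π
  | false => πᶜ

/-- `A` permutes with `B`: `AB = BA`. -/
def Permutes {G : Type*} [Group G] (A B : Subgroup G) : Prop :=
  (A : Set G) * (B : Set G) = (B : Set G) * (A : Set G)

/-- `𝓗` is a complete Hall `σ`-set of `G`: each non-trivial member is a Hall `σ i`-subgroup for
some `i`, and `𝓗` has exactly one member that is a Hall `σ i`-subgroup whenever some prime of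
`σ i` divides the order of `G`. -/
def IsCompleteHallSet {ι : Type*} (σ : ι → Set Nat.Primes) {G : Type*} [Group G]
    (𝓗 : Set (Subgroup G)) : Prop :=
  (∀ H ∈ 𝓗, H ≠ ⊥ → ∃ i, IsHall (σ i) H) ∧
    ∀ i, (∃ p ∈ σ i, (p : ℕ) ∣ Nat.card G) → ∃! H, H ∈ 𝓗 ∧ IsHall (σ i) H

/-- `G` is `σ`-full: it possesses a complete Hall `σ`-set. -/
def IsSigmaFull {ι : Type*} (σ : ι → Set Nat.Primes) (G : Type*) [Group G] : Prop :=
  ∃ 𝓗 : Set (Subgroup G), IsCompleteHallSet σ 𝓗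

/-- `A` is `σ`-permutable in `G`: `G` is `σ`-full and `A` permutes with every Hall
`σ i`-subgroup of `G`, for all `i`. -/
def IsSigmaPermutable {ι : Type*} (σ : ι → Set Nat.Primes) {G : Type*} [Group G]
    (A : Subgroup G) : Prop :=
  IsSigmaFull σ G ∧ ∀ i, ∀ H : Subgroup G, IsHall (σ i) H → Permutes A H

theorem permutes_of_subset {G : Type*} [Group G] {A H : Subgroup G}
    (h : ∀ y ∈ H, ∀ x ∈ A, ∃ x' ∈ A, ∃ y' ∈ H, y * x = x' * y') : Permutes A H := by
  apply Set.Subset.antisymm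
  · rintro _ ⟨x, hx, y, hy, rfl⟩
    obtain ⟨x', hx', y', hy', e⟩ := h y⁻¹ (inv_mem hy) x⁻¹ (inv_mem hx)
    refine ⟨y'⁻¹, inv_mem hy', x'⁻¹, inv_mem hx', ?_⟩
    have := congrArg (·⁻¹) e
    simpa using this.symm
  · rintro _ ⟨y, hy, x, hx, rfl⟩
    obtain ⟨x', hx', y', hy', e⟩ := h y hy x hx
    exact ⟨x', hx', y', hy', e.symm⟩

theorem Permutes.sSup {G : Type*} [Group G] {S : Set (Subgroup G)} {H : Subgroup G}
    (h : ∀ A ∈ S, Permutes A H) : Permutes (sSup S) H := by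
  apply permutes_of_subset
  intro y hy x hx
  rw [sSup_eq_iSup'] at hx
  induction hx using Subgroup.iSup_induction' generalizing y with
  | hp i x hx =>
    have : y * x ∈ ((i : Subgroup G) : Set G) * (H : Set G) := by
      rw [h i i.2]; exact ⟨y, hy, x, hx, rfl⟩
    obtain ⟨x', hx', y', hy', e⟩ := this
    exact ⟨x', le_sSup i.2 hx', y', hy', e.symm⟩
  | h1 => exact ⟨1, one_mem _, y, hy, by simp⟩
  | hmul a b _ _ iha ihb =>
    obtain ⟨a', ha', y', hy', e⟩ := iha y hy
    obtain ⟨b', hb', y'', hy'', e'⟩ := ihb y' hy'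
    exact ⟨a' * b', mul_mem ha' hb', y'', hy'', by
      rw [← mul_assoc, e, mul_assoc, e', mul_assoc]⟩

theorem IsSigmaPermutable.sSup {ι : Type*} {σ : ι → Set Nat.Primes} {G : Type*} [Group G]
    (hG : IsSigmaFull σ G) {S : Set (Subgroup G)} (h : ∀ A ∈ S, IsSigmaPermutable σ A) :
    IsSigmaPermutable σ (sSup S) :=
  ⟨hG, fun i H hH => Permutes.sSup fun A hA => (h A hA).2 i H hH⟩

/-- The set `𝓛_σ(G)` of all `σ`-permutable subgroups of `G`. -/
def SigmaPermSubgroups {ι : Type*} (σ : ι → Set Nat.Primes) (G : Type*) [Group G] : Type _ :=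
  {A : Subgroup G // IsSigmaPermutable σ A}

instance {ι : Type*} (σ : ι → Set Nat.Primes) (G : Type*) [Group G] :
    PartialOrder (SigmaPermSubgroups σ G) :=
  inferInstanceAs (PartialOrder {A : Subgroup G // IsSigmaPermutable σ A})

/-- `𝓛_σ(G)`, ordered by inclusion, is a lattice: the join of `A` and `B` is `⟨A, B⟩`, and their
meet is the largest `σ`-permutable subgroup contained in both. -/
instance {ι : Type*} (σ : ι → Set Nat.Primes) (G : Type*) [Group G] :
    Lattice (SigmaPermSubgroups σ G) where
  sup A B := ⟨A.1 ⊔ B.1, by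
    rw [← sSup_pair]
    apply IsSigmaPermutable.sSup A.2.1
    rintro C (rfl | rfl)
    exacts [A.2, B.2]⟩
  le_sup_left A B := (le_sup_left : A.1 ≤ A.1 ⊔ B.1)
  le_sup_right A B := (le_sup_right : B.1 ≤ A.1 ⊔ B.1)
  sup_le A B C hA hB := (sup_le hA hB : A.1 ⊔ B.1 ≤ C.1)
  inf A B := ⟨sSup {C | IsSigmaPermutable σ C ∧ C ≤ A.1 ∧ C ≤ B.1},
    IsSigmaPermutable.sSup A.2.1 fun _ hC => hC.1⟩
  inf_le_left A B :=
    (sSup_le fun _ hC => hC.2.1 : sSup {C | IsSigmaPermutable σ C ∧ C ≤ A.1 ∧ C ≤ B.1} ≤ A.1)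
  inf_le_right A B :=
    (sSup_le fun _ hC => hC.2.2 : sSup {C | IsSigmaPermutable σ C ∧ C ≤ A.1 ∧ C ≤ B.1} ≤ B.1)
  le_inf A B C hB hC :=
    (le_sSup ⟨A.2, hB, hC⟩ : A.1 ≤ sSup {X | IsSigmaPermutable σ X ∧ X ≤ B.1 ∧ X ≤ C.1})

/-- The set `𝓛_n(G)` of all normal subgroups of `G`. -/
def NormalSubgroups (G : Type*) [Group G] : Type _ :=
  {N : Subgroup G // N.Normal}

/-- `𝓛_n(G)` is a lattice, with join `⟨M, N⟩ = MN` and meet `M ∩ N`. -/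
instance (G : Type*) [Group G] : Lattice (NormalSubgroups G) :=
  Subtype.lattice
    (fun {M N} (_ : M.Normal) (_ : N.Normal) => (inferInstance : (M ⊔ N).Normal))
    (fun {M N} (_ : M.Normal) (_ : N.Normal) => (inferInstance : (M ⊓ N).Normal))

/-- The element `a` of a lattice is meet-distributive. -/
def IsMeetDistributive {α : Type*} [Lattice α] (a : α) : Prop :=
  ∀ b c : α, a ⊓ (b ⊔ c) = (a ⊓ b) ⊔ (a ⊓ c)

/-- The lattice `α` is distributive. -/
def IsDistributive (α : Type*) [Lattice α] : Prop :=
  ∀ a : α, IsMeetDistributive a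

/-! ### Operator-isomorphic sections -/

/-- `H` is invariant under conjugation by the elements of `O`. -/
def IsInvariantUnder {G : Type*} [Group G] (O H : Subgroup G) : Prop :=
  ∀ a ∈ O, ∀ x ∈ H, a⁻¹ * x * a ∈ H

/-- `H/K` is a section of `G` on which `O` acts by conjugation, `(hK)^a = h^a K`. -/
def IsOperatorSection {G : Type*} [Group G] (O H K : Subgroup G) : Prop :=
  K ≤ H ∧ (K.subgroupOf H).Normal ∧ IsInvariantUnder O H ∧ IsInvariantUnder O K

/-- `H/K` and `L/K` are `O`-isomorphic sections of `G`: `O` acts on both of them by conjugation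
and there is a group isomorphism `φ : H/K → L/K` with `φ ((hK)^a) = (φ (hK))^a` for all `a ∈ O`
and `h ∈ H`. The last equation is written with representatives `l` of `φ (hK)` and
`h' = h^a`, `l' = l^a`. -/
def AreOperatorIsomorphic {G : Type*} [Group G] (O H L K : Subgroup G) : Prop :=
  IsOperatorSection O H K ∧ IsOperatorSection O L K ∧
    ∃ (_ : (K.subgroupOf H).Normal) (_ : (K.subgroupOf L).Normal)
      (φ : (H ⧸ K.subgroupOf H) ≃* (L ⧸ K.subgroupOf L)),
      ∀ a ∈ O, ∀ (h h' : H) (l l' : L), (h' : G) = a⁻¹ * h * a → (l' : G) = a⁻¹ * l * a →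
        φ (h : H ⧸ K.subgroupOf H) = (l : L ⧸ K.subgroupOf L) →
        φ (h' : H ⧸ K.subgroupOf H) = (l' : L ⧸ K.subgroupOf L)

/-- In every factor group `G/R`, any two `O^τ(G/R)`-isomorphic sections `H/K` and `L/K`, where
`K`, `H` and `L` are `σ`-permutable `τ`-subgroups of `G/R`, coincide. -/
def IsomorphicSectionsCoincide {ι : Type*} (σ : ι → Set Nat.Primes) (τ : Set Nat.Primes)
    (G : Type*) [Group G] : Prop :=
  ∀ (R : Subgroup G) [R.Normal] (K H L : Subgroup (G ⧸ R)),
    IsSigmaPermutable σ K → IsSigmaPermutable σ H → IsSigmaPermutable σ L →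
    IsPiGroup τ K → IsPiGroup τ H → IsPiGroup τ L →
    AreOperatorIsomorphic (piResidual τ (G ⧸ R)) H L K → H = L

end SigmaPerm

/-!
Call a subgroup a *member* if it is `σ^π`-permutable in `G`. Write `O = O^π(G)`, `O' = O^π'(G)` and let
`D` be the `π`-decomposable residual. As `O` and `O'` are generated by the Hall `π'`-subgroups and by
the Hall `π`-subgroups respectively, `D = O ∩ O'`.

The basic fact about a member `A` is that the subgroup `hallJoin πᶜ A` generated by the intersections
of `A` with the Hall `π'`-subgroups `Q` is normalized by every Hall `π`-subgroup `P`: for `x ∈ P`, the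
join of `A` and `A^x` is a member inside `AP`, so all three meet `Q` in the same subgroup
(`HallPerm.conj_inf_le`). Hence `O'` normalizes `hallJoin πᶜ A`, and `O` normalizes `hallJoin π A`;
since `A` is generated by the two, `D` normalizes every member. A member which is a `π`-group lies
in all Hall `π`-subgroups and is normalized by `O`; conversely such subgroups are members. All
subgroups containing `D` are members. Only the existence of Hall subgroups and their lifting from
quotients is needed, never their conjugacy, so the theorem of Schur and Zassenhaus on existence
suffices.

Suppose that the lattice is distributive. The subgroups of `G / D` form a distributive lattice, so
`G / D` is cyclic by Ore's theorem. For members `A`, `B` and `a ∈ A`, `b ∈ B`, the commutator relating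
`ba` to `ab` lies in `D ∩ ⟨A, B⟩ = (D ∩ A)(D ∩ B)`; as `D` normalizes `A` and `B`, this gives `ba ∈ AB`
(`permutes_of_joinSplits`). For two `O`-isomorphic `π`-sections `H / K` and `L / K`
(`SectionCorr.eq`), induction on `|H : K|` reduces to `H ∩ L = K`. Then the subgroup of products of
corresponding elements, a "diagonal" between `H` and `L`, forces `H ∩ O ≤ K` and `L ∩ O ≤ K`, so that
`HL / K` is cyclic, and `H = L` because the two sections have the same order.

Conversely, if members permute, their meets are intersections and the lattice is modular, so only
diamonds have to be excluded. Meet-distributivity of `D` turns a diamond into one below `D`. There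
all members are normal in `D`, so the diamond lives in an abelian section, with bottom `M` say. Modulo
the normal closure of `hallJoin πᶜ M`, which adds only a `π'`-part to `M`, the `π`-parts of its middle
terms are perspective, hence `O`-isomorphic, `π`-sections, and they coincide by condition 2
(`IsAbelianDiamond.mem_of_pow_mem`). Condition 3 disposes of the `π'`-parts. So the part of the
diamond below `D` collapses, and the rest lives in a section of the cyclic group `G / D`, which leaves
no room for a diamond. Distributivity of the lattice of normal subgroups is a consequence and plays
no role in this direction.
-/

namespace SigmaPerm

variable {G : Type*} [Group G] {π : Set Nat.Primes}

/-! ### `π`-numbers -/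

theorem IsPiNumber.of_dvd {m n : ℕ} (hn : IsPiNumber π n) (h : m ∣ n) : IsPiNumber π m :=
  fun p hp => hn p (hp.trans h)

theorem IsPiNumber.mul {m n : ℕ} (hm : IsPiNumber π m) (hn : IsPiNumber π n) :
    IsPiNumber π (m * n) :=
  fun p hp => (p.2.dvd_mul.mp hp).elim (hm p) (hn p)

theorem isPiNumber_one : IsPiNumber π 1 := fun p hp => (p.2.one_lt.ne' (Nat.dvd_one.mp hp)).elim

theorem IsPiNumber.coprime {m n : ℕ} (hm : IsPiNumber π m) (hn : IsPiNumber πᶜ n) :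
    m.Coprime n := by
  refine Nat.coprime_of_dvd fun p hp h1 h2 => ?_
  exact hn ⟨p, hp⟩ h2 (hm ⟨p, hp⟩ h1)

theorem IsPiNumber.eq_one {m : ℕ} (hm : IsPiNumber π m) (hm' : IsPiNumber πᶜ m) : m = 1 := by
  simpa using hm.coprime hm'

/-! ### Products of subgroups -/

/-- If every element of `L` is a product of an element of `K` and one of `H`, then `H` has the
same index in `K` as in `L`: the cosets of `H` in `L` are represented by elements of `K`. -/
theorem relIndex_eq_of_forall_exists {H K L : Subgroup G} (hKL : K ≤ L)
    (h : ∀ z ∈ L, ∃ k ∈ K, k⁻¹ * z ∈ H) : H.relIndex K = H.relIndex L := by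
  refine Nat.card_eq_of_bijective (Subgroup.quotientSubgroupOfEmbeddingOfLE H hKL)
    ⟨(Subgroup.quotientSubgroupOfEmbeddingOfLE H hKL).injective, fun q => ?_⟩
  induction q using QuotientGroup.induction_on with
  | H z =>
    obtain ⟨k, hk, hz⟩ := h z z.2
    refine ⟨((⟨k, hk⟩ : K) : K ⧸ H.subgroupOf K), ?_⟩
    rw [Subgroup.quotientSubgroupOfEmbeddingOfLE_apply_mk]
    exact QuotientGroup.eq.mpr (by simpa [Subgroup.mem_subgroupOf] using hz)

theorem exists_of_relIndex_eq [Finite G] {H K L : Subgroup G} (hKL : K ≤ L)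
    (h : H.relIndex K = H.relIndex L) : ∀ z ∈ L, ∃ k ∈ K, k⁻¹ * z ∈ H := by
  intro z hz
  have hb : Function.Bijective (Subgroup.quotientSubgroupOfEmbeddingOfLE H hKL) :=
    (Nat.bijective_iff_injective_and_card _).mpr
      ⟨(Subgroup.quotientSubgroupOfEmbeddingOfLE H hKL).injective, h⟩
  obtain ⟨q, hq⟩ := hb.2 ((⟨z, hz⟩ : L) : L ⧸ H.subgroupOf L)
  induction q using QuotientGroup.induction_on with
  | H k =>
    rw [Subgroup.quotientSubgroupOfEmbeddingOfLE_apply_mk] at hq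
    exact ⟨k, k.2, by simpa [Subgroup.mem_subgroupOf] using QuotientGroup.eq.mp hq⟩

/-- A finite group is the product of two subgroups of coprime indices. -/
theorem exists_mul_of_coprime_relIndex [Finite G] {X Y Z : Subgroup G} (hX : X ≤ Z) (hY : Y ≤ Z)
    (h : (X.relIndex Z).Coprime (Y.relIndex Z)) : ∀ z ∈ Z, ∃ x ∈ X, ∃ y ∈ Y, z = x * y := by
  have h1 : Y.relIndex X * X.relIndex Z = X.relIndex Y * Y.relIndex Z := by
    have h2 := Subgroup.relIndex_inf_mul_relIndex Y X Z
    have h3 := Subgroup.relIndex_inf_mul_relIndex X Y Z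
    rw [inf_eq_left.mpr hX] at h2
    rw [inf_eq_left.mpr hY] at h3
    rw [h2, h3, inf_comm]
  have h4 : Y.relIndex Z ∣ Y.relIndex X := by
    refine (h.symm.dvd_mul_right (k := Y.relIndex Z) (m := Y.relIndex X)).mp ?_
    rw [h1]
    exact dvd_mul_left _ _
  have h5 : Y.relIndex X = Y.relIndex Z :=
    le_antisymm (Subgroup.relIndex_le_of_le_right hX Subgroup.index_ne_zero_of_finite)
      (Nat.le_of_dvd (Nat.pos_of_ne_zero Subgroup.index_ne_zero_of_finite) h4)
  intro z hz
  obtain ⟨x, hx, hxz⟩ := exists_of_relIndex_eq hX h5 z hz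
  exact ⟨x, hx, x⁻¹ * z, hxz, by group⟩

theorem exists_mul_of_isPiNumber_relIndex [Finite G] {X Y Z : Subgroup G} (hX : X ≤ Z)
    (hY : Y ≤ Z) (h1 : IsPiNumber π (X.relIndex Z)) (h2 : IsPiNumber πᶜ (Y.relIndex Z)) :
    ∀ z ∈ Z, ∃ x ∈ X, ∃ y ∈ Y, z = x * y :=
  exists_mul_of_coprime_relIndex hX hY (h1.coprime h2)

theorem Permutes.symm {A B : Subgroup G} (h : Permutes A B) : Permutes B A := Eq.symm h

theorem Permutes.exists_mul {A B : Subgroup G} (h : Permutes A B) {a b : G} (ha : a ∈ A)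
    (hb : b ∈ B) : ∃ a' ∈ A, ∃ b' ∈ B, b * a = a' * b' := by
  have : b * a ∈ (A : Set G) * (B : Set G) := by
    rw [h]; exact ⟨b, hb, a, ha, rfl⟩
  obtain ⟨a', ha', b', hb', e⟩ := this
  exact ⟨a', ha', b', hb', e.symm⟩

theorem Permutes.mem_sup {A B : Subgroup G} (h : Permutes A B) {x : G} :
    x ∈ A ⊔ B ↔ ∃ a ∈ A, ∃ b ∈ B, x = a * b := by
  constructor
  · intro hx
    rw [Subgroup.sup_eq_closure_mul] at hx
    induction hx using Subgroup.closure_induction with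
    | mem x hx =>
      obtain ⟨a, ha, b, hb, e⟩ := hx
      exact ⟨a, ha, b, hb, e.symm⟩
    | one => exact ⟨1, one_mem _, 1, one_mem _, by simp⟩
    | mul x y _ _ hx hy =>
      obtain ⟨a, ha, b, hb, rfl⟩ := hx
      obtain ⟨c, hc, d, hd, rfl⟩ := hy
      obtain ⟨c', hc', b', hb', e⟩ := h.exists_mul hc hb
      exact ⟨a * c', mul_mem ha hc', b' * d, mul_mem hb' hd, by
        rw [mul_assoc, ← mul_assoc b, e]; group⟩
    | inv x _ hx =>
      obtain ⟨a, ha, b, hb, rfl⟩ := hx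
      obtain ⟨a', ha', b', hb', e⟩ := h.exists_mul (inv_mem ha) (inv_mem hb)
      exact ⟨a', ha', b', hb', by rw [mul_inv_rev, e]⟩
  · rintro ⟨a, ha, b, hb, rfl⟩
    exact mul_mem (Subgroup.mem_sup_left ha) (Subgroup.mem_sup_right hb)

theorem Permutes.relIndex_sup {A B : Subgroup G} (h : Permutes A B) :
    B.relIndex (A ⊔ B) = B.relIndex A := by
  refine (relIndex_eq_of_forall_exists le_sup_left fun z hz => ?_).symm
  obtain ⟨a, ha, b, hb, rfl⟩ := h.mem_sup.mp hz
  exact ⟨a, ha, by simpa using hb⟩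

theorem permutes_of_le_normalizer {A B : Subgroup G} (h : B ≤ Subgroup.normalizer (A : Set G)) :
    Permutes A B :=
  permutes_of_subset fun y hy x hx =>
    ⟨y * x * y⁻¹, (Subgroup.mem_normalizer_iff.mp (h hy) x).mp hx, y, hy, by group⟩

theorem Permutes.of_le {A B : Subgroup G} (h : A ≤ B) : Permutes A B :=
  permutes_of_subset fun y hy x hx => ⟨1, one_mem _, y * x, mul_mem hy (h hx), by simp⟩

theorem Permutes.sup {A B H : Subgroup G} (hA : Permutes A H) (hB : Permutes B H) :
    Permutes (A ⊔ B) H := by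
  rw [← sSup_pair]
  apply Permutes.sSup
  rintro C (rfl | rfl)
  exacts [hA, hB]

theorem permutes_map {G' : Type*} [Group G'] (f : G →* G') {A B : Subgroup G}
    (h : Permutes A B) : Permutes (A.map f) (B.map f) := by
  have := congrArg (fun s => f '' s) h
  simpa [Permutes, Set.image_mul] using this

theorem permutes_comap {G' : Type*} [Group G'] {f : G →* G'}
    {A : Subgroup G'} {B : Subgroup G} (h : Permutes A (B.map f)) : Permutes (A.comap f) B := by
  refine permutes_of_subset fun y hy x hx => ?_
  obtain ⟨a, ha, b, ⟨b', hb', rfl⟩, e⟩ := h.exists_mul hx (Subgroup.mem_map_of_mem f hy)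
  refine ⟨y * x * b'⁻¹, ?_, b', hb', by group⟩
  rw [Subgroup.mem_comap]
  simpa [e] using ha

theorem le_normalizer_of_forall {H : Subgroup G} {O : Subgroup G}
    (h : ∀ a ∈ O, ∀ x ∈ H, a * x * a⁻¹ ∈ H) : O ≤ Subgroup.normalizer (H : Set G) := by
  intro a ha
  rw [Subgroup.mem_normalizer_iff]
  refine fun x => ⟨h a ha x, fun hx => ?_⟩
  have := h a⁻¹ (inv_mem ha) _ hx
  simpa [mul_assoc] using this

theorem conj_mem_of_le_normalizer {H O : Subgroup G} (h : O ≤ Subgroup.normalizer (H : Set G))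
    {a x : G} (ha : a ∈ O) (hx : x ∈ H) : a * x * a⁻¹ ∈ H :=
  (Subgroup.mem_normalizer_iff.mp (h ha) x).mp hx

theorem isInvariantUnder_iff {O H : Subgroup G} :
    IsInvariantUnder O H ↔ O ≤ Subgroup.normalizer (H : Set G) := by
  refine ⟨fun h => le_normalizer_of_forall fun a ha x hx => ?_, fun h a ha x hx => ?_⟩
  · simpa using h a⁻¹ (inv_mem ha) x hx
  · simpa using conj_mem_of_le_normalizer h (inv_mem ha) hx

theorem le_normalizer_inf {O H K : Subgroup G} (hH : O ≤ Subgroup.normalizer (H : Set G))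
    (hK : O ≤ Subgroup.normalizer (K : Set G)) :
    O ≤ Subgroup.normalizer ((H ⊓ K : Subgroup G) : Set G) :=
  le_normalizer_of_forall fun _ ha _ hx =>
    ⟨conj_mem_of_le_normalizer hH ha hx.1, conj_mem_of_le_normalizer hK ha hx.2⟩

theorem le_normalizer_sSup {O : Subgroup G} {S : Set (Subgroup G)}
    (h : ∀ H ∈ S, ∀ a ∈ O, ∀ x ∈ H, a * x * a⁻¹ ∈ sSup S) :
    O ≤ Subgroup.normalizer ((sSup S : Subgroup G) : Set G) := by
  refine le_normalizer_of_forall fun a ha x hx => ?_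
  have : sSup S ≤ (sSup S).comap (MulAut.conj a).toMonoidHom :=
    sSup_le fun H hH y hy => by simpa using h H hH a ha y hy
  simpa using this hx

theorem le_normalizer_sup {O H K : Subgroup G} (hH : O ≤ Subgroup.normalizer (H : Set G))
    (hK : O ≤ Subgroup.normalizer (K : Set G)) :
    O ≤ Subgroup.normalizer ((H ⊔ K : Subgroup G) : Set G) := by
  rw [← sSup_pair]
  refine le_normalizer_sSup ?_
  rintro C (rfl | rfl) a ha x hx
  · exact (le_sSup (by simp) : C ≤ _) (conj_mem_of_le_normalizer hH ha hx)
  · exact (le_sSup (by simp) : C ≤ _) (conj_mem_of_le_normalizer hK ha hx)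

/-! ### Existence and lifting of Hall subgroups -/

theorem IsHall.map {G' : Type*} [Group G'] {f : G →* G'} (hf : Function.Surjective f)
    {P : Subgroup G} (h : IsHall π P) : IsHall π (P.map f) :=
  ⟨h.1.of_dvd (Subgroup.card_map_dvd _ f), h.2.of_dvd (Subgroup.index_map_dvd _ hf)⟩

theorem IsHall.conj {P : Subgroup G} (h : IsHall π P) (x : G) :
    IsHall π (P.map (MulAut.conj x).toMonoidHom) :=
  h.map (MulAut.conj x).surjective

theorem IsPiSeparable.compl (h : IsPiSeparable π G) : IsPiSeparable πᶜ G := by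
  obtain ⟨n, s, h0, hn, hs, h⟩ := h
  exact ⟨n, s, h0, hn, hs, fun i hi => ⟨(h i hi).1, by rw [compl_compl]; exact (h i hi).2.symm⟩⟩

/-- Let `M ≤ N` be normal subgroups of `G` and `N ≤ T`. If `T / N` is a `π`-group and `N / M` is a
`π`-group or a `π'`-group, then `T` has a subgroup containing `M`, of `π'`-index, whose quotient
by `M` is a `π`-group. When `N / M` is a `π'`-group, this is the theorem of Schur and Zassenhaus
in `T / M`. -/
theorem exists_hall_step [Finite G] {M N T : Subgroup G} [M.Normal] [N.Normal] (hMN : M ≤ N)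
    (hNT : N ≤ T) (hT : IsPiNumber π (N.relIndex T))
    (h : IsPiNumber π (M.relIndex N) ∨ IsPiNumber πᶜ (M.relIndex N)) :
    ∃ X, M ≤ X ∧ X ≤ T ∧ IsPiNumber π (M.relIndex X) ∧ IsPiNumber πᶜ (X.relIndex T) := by
  rcases h with h | h
  · refine ⟨T, hMN.trans hNT, le_rfl, ?_, by simpa using isPiNumber_one⟩
    rw [← Subgroup.relIndex_mul_relIndex M N T hMN hNT]
    exact h.mul hT
  · set f : T →* G ⧸ M := (QuotientGroup.mk' M).comp T.subtype
    set q : T →* f.range := f.rangeRestrict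
    have hq : Function.Surjective q := f.rangeRestrict_surjective
    have hker : q.ker = M.subgroupOf T := by
      ext x
      simp [q, f, MonoidHom.mem_ker, Subgroup.mem_subgroupOf]
    set N' : Subgroup f.range := (N.subgroupOf T).map q
    have hN' : N'.Normal := Subgroup.Normal.map inferInstance q hq
    have hcard : Nat.card N' = M.relIndex N := by
      rw [← Subgroup.relIndex_ker, hker, Subgroup.relIndex_subgroupOf hNT]
    have hidx : N'.index = N.relIndex T := by
      refine Subgroup.index_map_eq _ hq ?_
      rw [hker]
      exact Subgroup.comap_mono hMN
    obtain ⟨C, hC⟩ := Subgroup.exists_right_complement'_of_coprime (N := N')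
      (by rw [hcard, hidx]; exact (hT.coprime h).symm)
    have hCcard : Nat.card C = N.relIndex T := by rw [← hidx]; exact hC.symm.index_eq_card.symm
    have hCidx : C.index = M.relIndex N := by rw [← hcard]; exact hC.index_eq_card
    have hX : ((C.comap q).map T.subtype).subgroupOf T = C.comap q :=
      Subgroup.comap_map_eq_self_of_injective T.subtype_injective _
    have hXT : (C.comap q).map T.subtype ≤ T := Subgroup.map_subtype_le _
    refine ⟨(C.comap q).map T.subtype, ?_, hXT, ?_, ?_⟩
    · intro x hx
      refine ⟨⟨x, hNT (hMN hx)⟩, ?_, rfl⟩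
      have : (⟨x, hNT (hMN hx)⟩ : T) ∈ q.ker := by rw [hker]; exact hx
      rw [SetLike.mem_coe, Subgroup.mem_comap, MonoidHom.mem_ker.mp this]
      exact one_mem _
    · rw [← Subgroup.relIndex_subgroupOf hXT, hX, ← hker, Subgroup.relIndex_ker,
        Subgroup.map_comap_eq_self_of_surjective hq, hCcard]
      exact hT
    · rw [Subgroup.relIndex, hX, Subgroup.index_comap_of_surjective _ hq, hCidx]
      exact h

/-- If `T / R` is a Hall `π`-subgroup of `G / R`, then `T` contains a Hall `π`-subgroup of `G`: it is
reached by descending along the intersections of `R` with a `π`-series of `G`. -/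
theorem IsPiSeparable.exists_hall_le [Finite G] (hG : IsPiSeparable π G) {R T : Subgroup G}
    [hR : R.Normal] (hRT : R ≤ T) (hT : IsPiNumber π (R.relIndex T))
    (hT' : IsPiNumber πᶜ T.index) : ∃ P, P ≤ T ∧ IsHall π P := by
  obtain ⟨n, s, h0, hn, hs, h⟩ := hG
  have key : ∀ k ≤ n, ∃ X, s (n - k) ⊓ R ≤ X ∧ X ≤ T ∧
      IsPiNumber π ((s (n - k) ⊓ R).relIndex X) ∧ IsPiNumber πᶜ X.index := by
    intro k
    induction k with
    | zero => exact fun _ => ⟨T, by simpa [hn] using hRT, le_rfl, by simpa [hn] using hT, hT'⟩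
    | succ k ih =>
      intro hk
      obtain ⟨X, hX1, hX2, hX3, hX4⟩ := ih (by omega)
      obtain ⟨i, hi⟩ : ∃ i, i = n - (k + 1) := ⟨_, rfl⟩
      have hi' : n - k = i + 1 := by omega
      rw [hi'] at hX1 hX3
      rw [← hi]
      have := hs i
      have := hs (i + 1)
      have hle := (h i (by omega)).1
      have hdvd : (s i ⊓ R).relIndex (s (i + 1) ⊓ R) ∣ (s i).relIndex (s (i + 1)) := by
        have e : s i ⊓ R = s i ⊓ (s (i + 1) ⊓ R) := by
          rw [← inf_assoc, inf_eq_left.mpr hle]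
        rw [e, Subgroup.inf_relIndex_right]
        have e2 := Subgroup.relIndex_dvd_index_of_normal ((s i).subgroupOf (s (i + 1)))
          ((s (i + 1) ⊓ R).subgroupOf (s (i + 1)))
        rwa [Subgroup.relIndex_subgroupOf inf_le_left] at e2
      obtain ⟨Y, hY1, hY2, hY3, hY4⟩ := exists_hall_step (π := π) (M := s i ⊓ R)
        (N := s (i + 1) ⊓ R) (inf_le_inf_right R hle) hX1 hX3
        ((h i (by omega)).2.imp (fun h => h.of_dvd hdvd) fun h => h.of_dvd hdvd)
      refine ⟨Y, hY1, hY2.trans hX2, hY3, ?_⟩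
      rw [← Subgroup.relIndex_mul_index hY2]
      exact hY4.mul hX4
  obtain ⟨X, -, hX2, hX3, hX4⟩ := key n le_rfl
  refine ⟨X, hX2, ?_, hX4⟩
  simpa [h0, IsPiGroup] using hX3

theorem IsPiSeparable.exists_hall [Finite G] (hG : IsPiSeparable π G) :
    ∃ P : Subgroup G, IsHall π P := by
  obtain ⟨P, -, hP⟩ := hG.exists_hall_le (R := ⊤) (T := ⊤) le_rfl
    (by simpa using isPiNumber_one) (by simpa using isPiNumber_one)
  exact ⟨P, hP⟩

/-- Every Hall subgroup of a quotient is the image of a Hall subgroup. -/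
theorem IsPiSeparable.exists_hall_map [Finite G] (hG : IsPiSeparable π G) {R : Subgroup G}
    [R.Normal] {Q : Subgroup (G ⧸ R)} (hQ : IsHall π Q) :
    ∃ P : Subgroup G, IsHall π P ∧ P.map (QuotientGroup.mk' R) = Q := by
  have hs := QuotientGroup.mk'_surjective R
  have hmap := Subgroup.map_comap_eq_self_of_surjective hs Q
  obtain ⟨P, hPT, hP⟩ := hG.exists_hall_le (R := R) (T := Q.comap (QuotientGroup.mk' R))
    (by simpa using (Subgroup.comap_mono (f := QuotientGroup.mk' R) (bot_le : ⊥ ≤ Q)))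
    (by
      have := Subgroup.relIndex_ker (Q.comap (QuotientGroup.mk' R)) (QuotientGroup.mk' R)
      rw [QuotientGroup.ker_mk', hmap] at this
      rw [this]; exact hQ.1)
    (by rw [Subgroup.index_comap_of_surjective _ hs]; exact hQ.2)
  refine ⟨P, hP, ?_⟩
  have hle : P.map (QuotientGroup.mk' R) ≤ Q := Subgroup.map_le_iff_le_comap.mpr hPT
  refine le_antisymm hle (Subgroup.relIndex_eq_one.mp (IsPiNumber.eq_one (π := π) ?_ ?_))
  · exact hQ.1.of_dvd (Subgroup.relIndex_dvd_card _ _)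
  · exact (hP.map hs).2.of_dvd (Subgroup.relIndex_dvd_index_of_le hle)

/-! ### Subgroups permuting with all Hall `π`- and `π'`-subgroups -/

/-- `A` permutes with all Hall `π`-subgroups and with all Hall `π'`-subgroups of `G`. This is
`σ^π`-permutability without the requirement that `G` be `σ^π`-full. -/
def HallPerm (π : Set Nat.Primes) (A : Subgroup G) : Prop :=
  (∀ P : Subgroup G, IsHall π P → Permutes A P) ∧ ∀ Q : Subgroup G, IsHall πᶜ Q → Permutes A Q

/-- `G` has Hall `π`-subgroups and Hall `π'`-subgroups. -/
def HasHall (π : Set Nat.Primes) (G : Type*) [Group G] : Prop :=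
  (∃ P : Subgroup G, IsHall π P) ∧ ∃ Q : Subgroup G, IsHall πᶜ Q

theorem HasHall.compl (h : HasHall π G) : HasHall πᶜ G := ⟨h.2, by rw [compl_compl]; exact h.1⟩

theorem HasHall.quotient (h : HasHall π G) (R : Subgroup G) [R.Normal] : HasHall π (G ⧸ R) :=
  let ⟨⟨_, hP⟩, _, hQ⟩ := h
  ⟨⟨_, hP.map (QuotientGroup.mk'_surjective R)⟩, _, hQ.map (QuotientGroup.mk'_surjective R)⟩

theorem HallPerm.compl {A : Subgroup G} (h : HallPerm π A) : HallPerm πᶜ A :=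
  ⟨h.2, by rw [compl_compl]; exact h.1⟩

theorem hallPerm_compl_iff {A : Subgroup G} : HallPerm πᶜ A ↔ HallPerm π A :=
  ⟨fun h => by simpa using h.compl, HallPerm.compl⟩

theorem HallPerm.sup {A B : Subgroup G} (hA : HallPerm π A) (hB : HallPerm π B) :
    HallPerm π (A ⊔ B) :=
  ⟨fun P hP => (hA.1 P hP).sup (hB.1 P hP), fun Q hQ => (hA.2 Q hQ).sup (hB.2 Q hQ)⟩

theorem HallPerm.of_normal (N : Subgroup G) [hN : N.Normal] : HallPerm π N :=
  ⟨fun _ _ => permutes_of_le_normalizer Subgroup.le_normalizer_of_normal,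
    fun _ _ => permutes_of_le_normalizer Subgroup.le_normalizer_of_normal⟩

theorem HallPerm.conj {A : Subgroup G} (h : HallPerm π A) (x : G) :
    HallPerm π (A.map (MulAut.conj x).toMonoidHom) := by
  have key : ∀ τ : Set Nat.Primes, (∀ P : Subgroup G, IsHall τ P → Permutes A P) →
      ∀ P : Subgroup G, IsHall τ P → Permutes (A.map (MulAut.conj x).toMonoidHom) P := by
    intro τ hτ P hP
    have h1 := permutes_map (MulAut.conj x).toMonoidHom (hτ _ (hP.conj x⁻¹))
    have h2 : (P.map (MulAut.conj x⁻¹).toMonoidHom).map (MulAut.conj x).toMonoidHom = P := by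
      rw [Subgroup.map_map]
      convert Subgroup.map_id P
      ext y
      simp [mul_assoc]
    rwa [h2] at h1
  exact ⟨key π h.1, key πᶜ h.2⟩

theorem HallPerm.map (hG : IsPiSeparable π G) [Finite G] {R : Subgroup G} [R.Normal]
    {A : Subgroup G} (h : HallPerm π A) : HallPerm π (A.map (QuotientGroup.mk' R)) := by
  refine ⟨fun P hP => ?_, fun Q hQ => ?_⟩
  · obtain ⟨P', hP', rfl⟩ := hG.exists_hall_map hP
    exact permutes_map _ (h.1 P' hP')
  · obtain ⟨Q', hQ', rfl⟩ := hG.compl.exists_hall_map hQ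
    exact permutes_map _ (h.2 Q' hQ')

theorem HallPerm.comap {G' : Type*} [Group G'] {f : G →* G'} (hf : Function.Surjective f)
    {A : Subgroup G'} (h : HallPerm π A) : HallPerm π (A.comap f) :=
  ⟨fun _ hP => permutes_comap (h.1 _ (hP.map hf)),
    fun _ hQ => permutes_comap (h.2 _ (hQ.map hf))⟩

/-- A Hall subgroup of `G` cuts out a Hall subgroup of every subgroup permuting with it. -/
theorem Permutes.relIndex_hall {A P : Subgroup G} (h : Permutes A P) (hP : IsHall π P) :
    IsPiNumber πᶜ (P.relIndex A) := by
  rw [← h.relIndex_sup]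
  exact hP.2.of_dvd (Subgroup.relIndex_dvd_index_of_le le_sup_right)

/-- If `A` permutes with the Hall `π`-subgroup `P`, then so does a subgroup `X` of `A` that has
`π`-index in `A ∩ Z` for some `Z` containing `X` and `P`: as `A ∩ P` has `π'`-index in `A ∩ Z`, this
intersection is `X (A ∩ P)`. -/
theorem Permutes.of_relIndex_inf [Finite G] {A X P : Subgroup G} (h : Permutes A P)
    (hP : IsHall π P) (hX : X ≤ A) {Z : Subgroup G} (hXZ : X ≤ Z) (hPZ : P ≤ Z)
    (hZ : IsPiNumber π (X.relIndex (A ⊓ Z))) : Permutes X P := by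
  refine permutes_of_subset fun y hy x hx => ?_
  obtain ⟨a, ha, y', hy', e⟩ := h.exists_mul (hX hx) hy
  have haZ : a ∈ Z := by
    have : a = y * x * y'⁻¹ := by rw [e]; group
    rw [this]
    exact mul_mem (mul_mem (hPZ hy) (hXZ hx)) (Z.inv_mem (hPZ hy'))
  have hdvd : (A ⊓ P).relIndex (A ⊓ Z) ∣ P.relIndex A := by
    have h2 : (A ⊓ P).relIndex (A ⊓ Z) = P.relIndex (A ⊓ Z) := by
      have : A ⊓ P = P ⊓ (A ⊓ Z) := by
        rw [inf_left_comm, inf_eq_left.mpr hPZ]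
      rw [this, Subgroup.inf_relIndex_right]
    rw [h2]
    have hpz : Permutes (A ⊓ Z) P := by
      refine permutes_of_subset fun z hz b hb => ?_
      obtain ⟨c, hc, d, hd, e⟩ := h.exists_mul hb.1 hz
      refine ⟨c, ⟨hc, ?_⟩, d, hd, e⟩
      have : c = z * b * d⁻¹ := by rw [e]; group
      rw [this]
      exact mul_mem (mul_mem (hPZ hz) hb.2) (Z.inv_mem (hPZ hd))
    rw [← h.relIndex_sup, ← hpz.relIndex_sup,
      ← Subgroup.relIndex_mul_relIndex P (A ⊓ Z ⊔ P) (A ⊔ P) le_sup_right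
        (sup_le_sup_right inf_le_left P)]
    exact dvd_mul_right _ _
  obtain ⟨u, hu, v, hv, rfl⟩ := exists_mul_of_isPiNumber_relIndex (le_inf hX hXZ)
    (inf_le_inf_left A hPZ) hZ ((h.relIndex_hall hP).of_dvd hdvd) a ⟨ha, haZ⟩
  exact ⟨u, hu, v * y', mul_mem hv.2 hy', by rw [e, mul_assoc]⟩

theorem HallPerm.inf_normal [Finite G] {A : Subgroup G} (h : HallPerm π A) (N : Subgroup G)
    [hN : N.Normal] : HallPerm π (A ⊓ N) := by
  have key : ∀ τ : Set Nat.Primes, (∀ P : Subgroup G, IsHall τ P → Permutes A P) →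
      ∀ P : Subgroup G, IsHall τ P → Permutes (A ⊓ N) P := by
    intro τ hτ P hP
    refine (hτ P hP).of_relIndex_inf hP inf_le_left (Z := N ⊔ P)
      (inf_le_right.trans le_sup_left) le_sup_right ?_
    have h1 : A ⊓ N = N ⊓ (A ⊓ (N ⊔ P)) := by
      rw [inf_left_comm, inf_eq_left.mpr (le_sup_left : N ≤ N ⊔ P)]
    rw [h1, Subgroup.inf_relIndex_right]
    have h2 : N.relIndex (A ⊓ (N ⊔ P)) ∣ N.relIndex (N ⊔ P) := by
      have := Subgroup.relIndex_dvd_index_of_normal (N.subgroupOf (N ⊔ P))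
        ((A ⊓ (N ⊔ P)).subgroupOf (N ⊔ P))
      rwa [Subgroup.relIndex_subgroupOf inf_le_right] at this
    rw [Subgroup.relIndex_sup_left] at h2
    exact hP.1.of_dvd (h2.trans (Subgroup.relIndex_dvd_card _ _))
  exact ⟨key π h.1, key πᶜ h.2⟩

theorem HallPerm.inf_of_permutes [Finite G] {A B : Subgroup G} (hA : HallPerm π A)
    (hB : HallPerm π B) (hAB : Permutes A B) : HallPerm π (A ⊓ B) := by
  have key : ∀ τ : Set Nat.Primes, (∀ P : Subgroup G, IsHall τ P → Permutes A P) →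
      (∀ P : Subgroup G, IsHall τ P → Permutes B P) →
      ∀ P : Subgroup G, IsHall τ P → Permutes (A ⊓ B) P := by
    intro τ hτ hτ' P hP
    refine (hτ P hP).of_relIndex_inf hP inf_le_left (Z := B ⊔ P)
      (inf_le_right.trans le_sup_left) le_sup_right ?_
    have h1 : A ⊓ B = B ⊓ (A ⊓ (B ⊔ P)) := by
      rw [inf_left_comm, inf_eq_left.mpr (le_sup_left : B ≤ B ⊔ P)]
    rw [h1, Subgroup.inf_relIndex_right]
    have hpz : Permutes (A ⊓ (B ⊔ P)) B := by
      refine permutes_of_subset fun z hz b hb => ?_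
      obtain ⟨c, hc, d, hd, e⟩ := hAB.exists_mul hb.1 hz
      refine ⟨c, ⟨hc, ?_⟩, d, hd, e⟩
      have : c = z * b * d⁻¹ := by rw [e]; group
      rw [this]
      exact mul_mem (mul_mem (Subgroup.mem_sup_left hz) hb.2)
        ((B ⊔ P).inv_mem (Subgroup.mem_sup_left hd))
    have h2 : B.relIndex (A ⊓ (B ⊔ P)) ∣ B.relIndex (P ⊔ B) := by
      rw [← hpz.relIndex_sup, ← Subgroup.relIndex_mul_relIndex B (A ⊓ (B ⊔ P) ⊔ B) (P ⊔ B)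
        le_sup_right (sup_le (inf_le_right.trans (by rw [sup_comm])) le_sup_right)]
      exact dvd_mul_right _ _
    rw [(hτ' P hP).symm.relIndex_sup] at h2
    exact hP.1.of_dvd (h2.trans (Subgroup.relIndex_dvd_card _ _))
  exact ⟨key π hA.1 hB.1, key πᶜ hA.2 hB.2⟩

/-! ### The subgroup generated by the intersections with Hall subgroups -/

/-- The subgroup of `A` generated by its intersections with the Hall `τ`-subgroups of `G`. -/
def hallJoin (τ : Set Nat.Primes) (A : Subgroup G) : Subgroup G :=
  sSup {X | ∃ Q : Subgroup G, IsHall τ Q ∧ X = A ⊓ Q}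

theorem inf_le_hallJoin {τ : Set Nat.Primes} (A : Subgroup G) {Q : Subgroup G} (hQ : IsHall τ Q) :
    A ⊓ Q ≤ hallJoin τ A :=
  le_sSup ⟨Q, hQ, rfl⟩

theorem hallJoin_le (τ : Set Nat.Primes) (A : Subgroup G) : hallJoin τ A ≤ A := by
  refine sSup_le ?_
  rintro _ ⟨Q, -, rfl⟩
  exact inf_le_left

/-- If `x` lies in a Hall `π`-subgroup `P`, then `A` and its conjugate by `x` have the same
intersection with each Hall `π'`-subgroup `Q`: their join is contained in `AP`, so that `A` has
`π`-index in it, and meets `Q` in no more than `A` does. -/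
theorem HallPerm.conj_inf_le [Finite G] {A P Q : Subgroup G} (h : HallPerm π A) (hP : IsHall π P)
    (hQ : IsHall πᶜ Q) {x : G} (hx : x ∈ P) :
    A.map (MulAut.conj x).toMonoidHom ⊓ Q ≤ A := by
  set B := A ⊔ A.map (MulAut.conj x).toMonoidHom
  have hB : HallPerm π B := h.sup (h.conj x)
  have hBP : B ≤ A ⊔ P := by
    refine sup_le le_sup_left ?_
    rintro _ ⟨a, ha, rfl⟩
    simpa using mul_mem (mul_mem (Subgroup.mem_sup_right hx) (Subgroup.mem_sup_left ha))
      (inv_mem (Subgroup.mem_sup_right hx) : x⁻¹ ∈ A ⊔ P)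
  have h1 : IsPiNumber π (A.relIndex B) := by
    refine hP.1.of_dvd (dvd_trans ?_ (Subgroup.relIndex_dvd_card A P))
    rw [← (h.1 P hP).symm.relIndex_sup, sup_comm P A,
      ← Subgroup.relIndex_mul_relIndex A B (A ⊔ P) le_sup_left hBP]
    exact dvd_mul_right _ _
  have h2 : IsPiNumber π ((A ⊓ Q).relIndex A) := by
    rw [Subgroup.inf_relIndex_left]
    simpa using (h.2 Q hQ).relIndex_hall hQ
  have h3 : IsPiNumber π ((A ⊓ Q).relIndex (B ⊓ Q)) := by
    have h4 := Subgroup.relIndex_mul_relIndex (A ⊓ Q) A B inf_le_left le_sup_left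
    have h5 := Subgroup.relIndex_mul_relIndex (A ⊓ Q) (B ⊓ Q) B
      (inf_le_inf_right Q le_sup_left) inf_le_left
    refine (h2.mul h1).of_dvd ?_
    rw [h4, ← h5]
    exact dvd_mul_right _ _
  have h6 : IsPiNumber πᶜ ((A ⊓ Q).relIndex (B ⊓ Q)) :=
    hQ.1.of_dvd ((Subgroup.relIndex_dvd_card _ _).trans (Subgroup.card_dvd_of_le inf_le_right))
  have h7 := Subgroup.relIndex_eq_one.mp (h3.eq_one h6)
  exact (inf_le_inf_right Q le_sup_right).trans (h7.trans inf_le_left)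

theorem HallPerm.le_normalizer_hallJoin [Finite G] {A P : Subgroup G} (h : HallPerm π A)
    (hP : IsHall π P) : P ≤ Subgroup.normalizer ((hallJoin πᶜ A : Subgroup G) : Set G) := by
  refine le_normalizer_sSup ?_
  rintro _ ⟨Q, hQ, rfl⟩ x hx y hy
  have hQ' := hQ.conj x
  have hmem : x * y * x⁻¹ ∈ Q.map (MulAut.conj x).toMonoidHom := ⟨y, hy.2, by simp⟩
  refine inf_le_hallJoin A hQ' ⟨h.conj_inf_le hP hQ' hx ⟨⟨y, hy.1, by simp⟩, hmem⟩, hmem⟩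

theorem HallPerm.le_normalizer_hallJoin' [Finite G] {A Q : Subgroup G} (h : HallPerm π A)
    (hQ : IsHall πᶜ Q) : Q ≤ Subgroup.normalizer ((hallJoin π A : Subgroup G) : Set G) := by
  simpa using h.compl.le_normalizer_hallJoin hQ

theorem HallPerm.eq_hallJoin_sup [Finite G] (hG : HasHall π G) {A : Subgroup G}
    (h : HallPerm π A) : A = hallJoin π A ⊔ hallJoin πᶜ A := by
  obtain ⟨⟨P, hP⟩, Q, hQ⟩ := hG
  refine le_antisymm (fun a ha => ?_) (sup_le (hallJoin_le _ _) (hallJoin_le _ _))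
  obtain ⟨x, hx, y, hy, rfl⟩ := exists_mul_of_isPiNumber_relIndex (π := π) (X := A ⊓ Q)
    (Y := A ⊓ P) (Z := A) inf_le_left inf_le_left
    (by rw [Subgroup.inf_relIndex_left]; simpa using (h.2 Q hQ).relIndex_hall hQ)
    (by rw [Subgroup.inf_relIndex_left]; exact (h.1 P hP).relIndex_hall hP) a ha
  exact mul_mem (Subgroup.mem_sup_right (inf_le_hallJoin A hQ hx))
    (Subgroup.mem_sup_left (inf_le_hallJoin A hP hy))

/-! ### The residuals -/

/-- `O^π(G)` is generated by the Hall `π'`-subgroups of `G`. -/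
theorem piResidual_eq [Finite G] (hG : HasHall π G) :
    piResidual π G = sSup {Q : Subgroup G | IsHall πᶜ Q} := by
  obtain ⟨-, Q, hQ⟩ := hG
  apply le_antisymm
  · refine sInf_le ⟨?_, ?_⟩
    · rw [← Subgroup.normalizer_eq_top_iff, eq_top_iff]
      refine le_normalizer_sSup fun H hH x _ y hy => ?_
      exact (le_sSup (show _ ∈ {Q : Subgroup G | IsHall πᶜ Q} from IsHall.conj hH x))
        ⟨y, hy, by simp⟩
    · have h1 := hQ.2.of_dvd (Subgroup.index_dvd_of_le
        (le_sSup (show Q ∈ {Q : Subgroup G | IsHall πᶜ Q} from hQ)))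
      rwa [compl_compl, Subgroup.index_eq_card] at h1
  · refine sSup_le fun Q hQ => le_sInf ?_
    rintro N ⟨hN, hN'⟩
    refine Subgroup.relIndex_eq_one.mp (IsPiNumber.eq_one (π := π) ?_ ?_)
    · refine IsPiNumber.of_dvd ?_ (Subgroup.relIndex_dvd_index_of_normal N Q)
      rw [Subgroup.index_eq_card]
      exact hN'
    · exact IsPiNumber.of_dvd hQ.1 (Subgroup.relIndex_dvd_card _ _)

instance piResidual_normal (π : Set Nat.Primes) (G : Type*) [Group G] :
    (piResidual π G).Normal := by
  refine ⟨fun x hx g => ?_⟩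
  unfold piResidual at hx ⊢
  rw [Subgroup.mem_sInf] at hx ⊢
  rintro N ⟨hN, hd⟩
  exact hN.conj_mem x (hx N ⟨hN, hd⟩) g

theorem IsHall.le_piResidual [Finite G] (hG : HasHall π G) {Q : Subgroup G} (hQ : IsHall πᶜ Q) :
    Q ≤ piResidual π G := by
  rw [piResidual_eq hG]
  exact le_sSup hQ

theorem IsHall.le_piResidual_compl [Finite G] (hG : HasHall π G) {P : Subgroup G}
    (hP : IsHall π P) : P ≤ piResidual πᶜ G :=
  IsHall.le_piResidual hG.compl (by rwa [compl_compl])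

theorem piResidual_index [Finite G] (hG : HasHall π G) : IsPiNumber π (piResidual π G).index := by
  obtain ⟨Q, hQ⟩ := hG.2
  simpa using hQ.2.of_dvd (Subgroup.index_dvd_of_le (hQ.le_piResidual hG))

theorem piResidual_le_normalizer [Finite G] (hG : HasHall π G) {X : Subgroup G}
    (h : ∀ Q : Subgroup G, IsHall πᶜ Q → Q ≤ Subgroup.normalizer (X : Set G)) :
    piResidual π G ≤ Subgroup.normalizer (X : Set G) := by
  rw [piResidual_eq hG]
  exact sSup_le h

theorem HallPerm.piResidual_le_normalizer_hallJoin [Finite G] (hG : HasHall π G) {A : Subgroup G}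
    (h : HallPerm π A) :
    piResidual π G ≤ Subgroup.normalizer ((hallJoin π A : Subgroup G) : Set G) :=
  piResidual_le_normalizer hG fun _ hQ => h.le_normalizer_hallJoin' hQ

theorem HallPerm.piResidual_compl_le_normalizer_hallJoin [Finite G] (hG : HasHall π G)
    {A : Subgroup G} (h : HallPerm π A) :
    piResidual πᶜ G ≤ Subgroup.normalizer ((hallJoin πᶜ A : Subgroup G) : Set G) :=
  h.compl.piResidual_le_normalizer_hallJoin hG.compl

theorem isPiGroup_sup [Finite G] {M N : Subgroup G} [N.Normal] (hM : IsPiGroup π M)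
    (hN : IsPiGroup π N) : IsPiGroup π (M ⊔ N : Subgroup G) := by
  have h := Subgroup.relIndex_mul_relIndex ⊥ N (M ⊔ N) bot_le le_sup_right
  rw [Subgroup.relIndex_bot_left, Subgroup.relIndex_bot_left, Subgroup.relIndex_sup_right] at h
  unfold IsPiGroup
  rw [← h]
  exact IsPiNumber.mul hN (IsPiNumber.of_dvd hM (Subgroup.relIndex_dvd_card _ _))

theorem isPiGroup_piCore [Finite G] (π : Set Nat.Primes) : IsPiGroup π (piCore π G) := by
  obtain ⟨M, hM⟩ := (Set.toFinite {N : Subgroup G | N.Normal ∧ IsPiGroup π N}).exists_maximal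
    ⟨⊥, inferInstance, by simpa [IsPiGroup] using isPiNumber_one⟩
  have := hM.1.1
  have : piCore π G = M := by
    refine le_antisymm (sSup_le ?_) (le_sSup hM.1)
    rintro N ⟨hN, hN'⟩
    exact le_sup_right.trans (hM.2 (y := M ⊔ N) ⟨inferInstance, isPiGroup_sup hM.1.2 hN'⟩
      le_sup_left)
  rw [this]
  exact hM.1.2

theorem piResidual_sup_compl [Finite G] (hG : HasHall π G) :
    piResidual π G ⊔ piResidual πᶜ G = ⊤ := by
  refine Subgroup.index_eq_one.mp (IsPiNumber.eq_one (π := π) ?_ ?_)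
  · exact (piResidual_index hG).of_dvd (Subgroup.index_dvd_of_le le_sup_left)
  · exact (piResidual_index hG.compl).of_dvd (Subgroup.index_dvd_of_le le_sup_right)

/-- A quotient of `G` is `π`-decomposable if and only if its kernel is the intersection of two normal
subgroups, one of `π`-index and the other of `π'`-index. -/
theorem piDecomposableResidual_eq [Finite G] (hG : HasHall π G) :
    piDecomposableResidual π G = piResidual π G ⊓ piResidual πᶜ G := by
  apply le_antisymm
  · refine sInf_le ⟨inferInstance, ?_⟩
    set E := piResidual π G ⊓ piResidual πᶜ G with hE
    have hs := QuotientGroup.mk'_surjective E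
    have h1 : ∀ τ : Set Nat.Primes, HasHall τ G → E = piResidual τ G ⊓ piResidual τᶜ G →
        (piResidual τᶜ G).map (QuotientGroup.mk' E) ≤ piCore τ (G ⧸ E) := by
      intro τ hτ hE
      refine le_sSup ⟨Subgroup.Normal.map inferInstance _ hs, ?_⟩
      unfold IsPiGroup
      rw [← Subgroup.relIndex_ker, QuotientGroup.ker_mk', hE, Subgroup.inf_relIndex_right]
      exact (piResidual_index hτ).of_dvd (Subgroup.relIndex_dvd_index_of_normal _ _)
    refine ⟨?_, ?_⟩
    · exact Subgroup.disjoint_of_coprime_natCard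
        ((isPiGroup_piCore π).coprime (isPiGroup_piCore πᶜ))
    · have h2 := h1 π hG hE
      have h3 := h1 πᶜ hG.compl (by rw [hE, compl_compl, inf_comm])
      rw [compl_compl] at h3
      rw [codisjoint_iff, eq_top_iff, ← Subgroup.map_top_of_surjective _ hs,
        ← piResidual_sup_compl hG, Subgroup.map_sup]
      exact sup_le (h3.trans le_sup_right) (h2.trans le_sup_left)
  · refine le_sInf ?_
    rintro N ⟨hN, hd⟩
    have hs := QuotientGroup.mk'_surjective N
    have h1 : ∀ τ : Set Nat.Primes, IsCompl (piCore τ (G ⧸ N)) (piCore τᶜ (G ⧸ N)) →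
        piResidual τᶜ G ≤ (piCore τ (G ⧸ N)).comap (QuotientGroup.mk' N) := by
      intro τ hτ
      have : (piCore τ (G ⧸ N)).Normal := by
        unfold piCore
        exact Subgroup.sSup_normal _ fun H hH => hH.1
      refine sInf_le ⟨inferInstance, ?_⟩
      have hc : Subgroup.IsComplement' (piCore τ (G ⧸ N)) (piCore τᶜ (G ⧸ N)) := by
        refine Subgroup.isComplement'_of_disjoint_and_mul_eq_univ hτ.disjoint ?_
        rw [← Subgroup.normal_mul, hτ.sup_eq_top, Subgroup.coe_top]
      have := hc.symm.index_eq_card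
      unfold IsPiGroup
      rw [← Subgroup.index_eq_card, Subgroup.index_comap_of_surjective _ hs, this]
      exact isPiGroup_piCore τᶜ
    have h2 := h1 π hd
    have h3 := h1 πᶜ (by rw [compl_compl]; exact hd.symm)
    rw [compl_compl] at h3
    intro x hx
    have h4 : QuotientGroup.mk' N x ∈ piCore π (G ⧸ N) ⊓ piCore πᶜ (G ⧸ N) := ⟨h2 hx.2, h3 hx.1⟩
    rw [hd.inf_eq_bot, Subgroup.mem_bot] at h4
    simpa using h4

/-- A subgroup permuting with all Hall subgroups is normalized by the residual `D`: it is generated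
by two subgroups, one normalized by `O^π(G)` and the other by `O^π'(G)`. -/
theorem HallPerm.residual_le_normalizer [Finite G] (hG : HasHall π G) {A : Subgroup G}
    (h : HallPerm π A) : piDecomposableResidual π G ≤ Subgroup.normalizer (A : Set G) := by
  rw [piDecomposableResidual_eq hG, h.eq_hallJoin_sup hG]
  exact le_normalizer_sup (inf_le_left.trans (h.piResidual_le_normalizer_hallJoin hG))
    (inf_le_right.trans (h.piResidual_compl_le_normalizer_hallJoin hG))

/-- All subgroups containing the residual `D` permute with all Hall subgroups, since `PD =
O^π'(G)` and `QD = O^π(G)` are normal for all Hall subgroups `P` and `Q`. -/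
theorem hallPerm_of_residual_le [Finite G] (hG : HasHall π G) {A : Subgroup G}
    (h : piDecomposableResidual π G ≤ A) : HallPerm π A := by
  have key : ∀ τ : Set Nat.Primes, HasHall τ G → piResidual τ G ⊓ piResidual τᶜ G ≤ A →
      ∀ P : Subgroup G, IsHall τ P → Permutes A P := by
    intro τ hτ hA P hP
    refine permutes_of_subset fun y hy x hx => ?_
    have hPO := hP.le_piResidual_compl hτ
    have h1 : y * x = x * (x⁻¹ * y * x) := by group
    have h2 : x⁻¹ * y * x ∈ piResidual τᶜ G := by
      simpa using (piResidual_normal τᶜ G).conj_mem y (hPO hy) x⁻¹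
    obtain ⟨d, hd, p, hp, e⟩ := exists_mul_of_isPiNumber_relIndex (π := τ)
      (X := piResidual τ G ⊓ piResidual τᶜ G) inf_le_right hPO
      (by
        rw [Subgroup.inf_relIndex_right]
        exact (piResidual_index hτ).of_dvd (Subgroup.relIndex_dvd_index_of_normal _ _))
      (hP.2.of_dvd (Subgroup.relIndex_dvd_index_of_le hPO)) _ h2
    exact ⟨x * d, mul_mem hx (hA hd), p, hp, by rw [h1, e, mul_assoc]⟩
  rw [piDecomposableResidual_eq hG] at h
  exact ⟨key π hG h, key πᶜ hG.compl (by rwa [compl_compl, inf_comm])⟩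

/-! ### `π`-subgroups permuting with all Hall subgroups -/

theorem HallPerm.le_hall [Finite G] {A P : Subgroup G} (h : HallPerm π A) (hA : IsPiGroup π A)
    (hP : IsHall π P) : A ≤ P :=
  Subgroup.relIndex_eq_one.mp (IsPiNumber.eq_one
    (IsPiNumber.of_dvd hA (Subgroup.relIndex_dvd_card _ _)) ((h.1 P hP).relIndex_hall hP))

theorem HallPerm.piResidual_le_normalizer [Finite G] (hG : HasHall π G) {A : Subgroup G}
    (h : HallPerm π A) (hA : IsPiGroup π A) :
    piResidual π G ≤ Subgroup.normalizer (A : Set G) := by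
  obtain ⟨P, hP⟩ := hG.1
  have h1 : hallJoin π A = A := by
    refine le_antisymm (hallJoin_le _ _) ?_
    have := inf_le_hallJoin A hP
    rwa [inf_eq_left.mpr (h.le_hall hA hP)] at this
  have := h.piResidual_le_normalizer_hallJoin hG
  rwa [h1] at this

/-- The converse of `HallPerm.le_hall` and `HallPerm.piResidual_le_normalizer`. -/
theorem hallPerm_of_le_hall [Finite G] (hG : HasHall π G) {A : Subgroup G}
    (h : ∀ P : Subgroup G, IsHall π P → A ≤ P)
    (hA : piResidual π G ≤ Subgroup.normalizer (A : Set G)) : HallPerm π A :=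
  ⟨fun P hP => .of_le (h P hP),
    fun _ hQ => permutes_of_le_normalizer ((hQ.le_piResidual hG).trans hA)⟩

/-! ### Groups with a distributive subgroup lattice -/

/-- The form in which distributivity is used, for the family of the subgroups satisfying `p`: a
member `A ≤ ⟨B, C⟩` is generated by its intersections with the members `B` and `C`. These
intersections need not be members, so this is weaker than distributivity; it passes to quotients
by taking preimages. -/
def JoinSplits (p : Subgroup G → Prop) : Prop :=
  ∀ A B C : Subgroup G, p A → p B → p C → A ≤ B ⊔ C → A ≤ (A ⊓ B) ⊔ (A ⊓ C)

theorem JoinSplits.quotient {p : Subgroup G → Prop} (h : JoinSplits p) (R : Subgroup G)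
    [R.Normal] {q : Subgroup (G ⧸ R) → Prop}
    (hq : ∀ A, q A → p (A.comap (QuotientGroup.mk' R))) : JoinSplits q := by
  intro A B C hA hB hC hABC
  have hs := QuotientGroup.mk'_surjective R
  have := h _ _ _ (hq A hA) (hq B hB) (hq C hC)
    (by rw [Subgroup.comap_sup_eq _ _ _ hs]; exact Subgroup.comap_mono hABC)
  rw [← Subgroup.comap_inf, ← Subgroup.comap_inf, Subgroup.comap_sup_eq _ _ _ hs] at this
  exact (Subgroup.comap_le_comap_of_surjective hs).mp this

/-- With `c = ab`, the intersections of `⟨c⟩` with `⟨a⟩` and with `⟨b⟩` are both centralized by `a`,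
hence so is `c`. -/
theorem JoinSplits.commute (h : JoinSplits fun _ : Subgroup G => True) (a b : G) :
    Commute a b := by
  have h1 := h (Subgroup.zpowers (a * b)) (Subgroup.zpowers a) (Subgroup.zpowers b) trivial
    trivial trivial (by
      rw [Subgroup.zpowers_le]
      exact mul_mem (Subgroup.mem_sup_left (Subgroup.mem_zpowers a))
        (Subgroup.mem_sup_right (Subgroup.mem_zpowers b)))
  have h2 : Subgroup.zpowers (a * b) ≤ Subgroup.centralizer {a} := by
    refine h1.trans (sup_le ?_ ?_)
    · rintro _ ⟨-, ⟨i, rfl⟩⟩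
      rw [Subgroup.mem_centralizer_singleton_iff]
      exact (Commute.refl a).zpow_left i
    · rintro x ⟨⟨i, hi⟩, ⟨j, hj⟩⟩
      rw [Subgroup.mem_centralizer_singleton_iff]
      have hc : Commute x (a * b) := hi ▸ (Commute.refl (a * b)).zpow_left i
      have hb : Commute x b := hj ▸ (Commute.refl b).zpow_left j
      have := (hc.mul_right hb.inv_right).eq
      rwa [mul_inv_cancel_right] at this
  have h3 := h2 (Subgroup.mem_zpowers _)
  rw [Subgroup.mem_centralizer_singleton_iff] at h3
  exact (mul_left_cancel (a := a) (by simpa [mul_assoc] using h3)).symm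

universe u in
/-- Ore's theorem for finite groups. Once the group `X` is known to be abelian, induction makes
`X / ⟨z⟩` cyclic for an element `z` of prime order, say generated by the class of `x`; if
`z ∉ ⟨x⟩`, distributivity gives `x, z ∈ ⟨xz⟩`. -/
theorem isCyclic_of_joinSplits {X : Type u} [Group X] [Finite X]
    (h : JoinSplits fun _ : Subgroup X => True) : IsCyclic X := by
  obtain ⟨n, hn⟩ : ∃ n, Nat.card X = n := ⟨_, rfl⟩
  induction n using Nat.strong_induction_on generalizing X with
  | _ n ih =>
    rcases subsingleton_or_nontrivial X with hX | hX
    · infer_instance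
    have hcard : 1 < Nat.card X := Finite.one_lt_card
    have hp := Nat.minFac_prime hcard.ne'
    have : Fact (Nat.card X).minFac.Prime := ⟨hp⟩
    obtain ⟨z, hz⟩ := exists_prime_orderOf_dvd_card' (Nat.card X).minFac (Nat.minFac_dvd _)
    have hcomm : ∀ a b : X, a * b = b * a := fun a b => h.commute a b
    have hN : (Subgroup.zpowers z).Normal :=
      ⟨fun x hx g => by rw [hcomm g x, mul_inv_cancel_right]; exact hx⟩
    have hlt : Nat.card (X ⧸ Subgroup.zpowers z) < n := by
      rw [← hn, Subgroup.card_eq_card_quotient_mul_card_subgroup (Subgroup.zpowers z),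
        Nat.card_zpowers, hz]
      exact (Nat.lt_mul_iff_one_lt_right Nat.card_pos).mpr hp.one_lt
    obtain ⟨q, hq⟩ := ih _ hlt (h.quotient (Subgroup.zpowers z) fun _ _ => trivial) rfl
    obtain ⟨x, rfl⟩ := QuotientGroup.mk'_surjective _ q
    have hgen : ∀ c : X, x ∈ Subgroup.zpowers c → z ∈ Subgroup.zpowers c → IsCyclic X := by
      refine fun c hx hzc => ⟨c, fun g => ?_⟩
      obtain ⟨i, hi⟩ := hq (QuotientGroup.mk' _ g)
      have hi' : QuotientGroup.mk' (Subgroup.zpowers z) (x ^ i) =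
          QuotientGroup.mk' (Subgroup.zpowers z) g := by simpa using hi
      obtain ⟨y, hy, e⟩ := (QuotientGroup.mk'_eq_mk' _).mp hi'
      rw [← e]
      exact mul_mem (zpow_mem hx i) ((Subgroup.zpowers_le.mpr hzc) hy)
    by_cases hzx : z ∈ Subgroup.zpowers x
    · exact hgen x (Subgroup.mem_zpowers x) hzx
    have hbot : ∀ t, t ∈ Subgroup.zpowers x → t ∈ Subgroup.zpowers z → t = 1 := by
      intro t htx htz
      have hle : Subgroup.zpowers t ≤ Subgroup.zpowers z := Subgroup.zpowers_le.mpr htz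
      have hdvd := Subgroup.card_dvd_of_le hle
      rw [Nat.card_zpowers, Nat.card_zpowers, hz] at hdvd
      rcases hp.eq_one_or_self_of_dvd _ hdvd with h1 | h1
      · exact orderOf_eq_one_iff.mp h1
      · refine (hzx ?_).elim
        have := Subgroup.eq_of_le_of_card_ge hle
          (by rw [Nat.card_zpowers, Nat.card_zpowers, hz, h1])
        exact (Subgroup.zpowers_le.mpr htx) (this ▸ Subgroup.mem_zpowers z)
    have h1 := h (Subgroup.zpowers (x * z)) (Subgroup.zpowers x) (Subgroup.zpowers z) trivial
      trivial trivial (by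
        rw [Subgroup.zpowers_le]
        exact mul_mem (Subgroup.mem_sup_left (Subgroup.mem_zpowers x))
          (Subgroup.mem_sup_right (Subgroup.mem_zpowers z)))
    have hperm : ∀ A B : Subgroup X, Permutes A B := fun A B =>
      permutes_of_subset fun y hy x hx => ⟨x, hx, y, hy, hcomm y x⟩
    obtain ⟨u, hu, v, hv, e⟩ := (hperm _ _).mem_sup.mp (h1 (Subgroup.mem_zpowers (x * z)))
    have e1 : u⁻¹ * x = v * z⁻¹ := by
      rw [inv_mul_eq_iff_eq_mul, ← mul_assoc, ← e, mul_inv_cancel_right]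
    have e2 := hbot (u⁻¹ * x) (mul_mem (inv_mem hu.2) (Subgroup.mem_zpowers x))
      (by rw [e1]; exact mul_mem hv.2 (inv_mem (Subgroup.mem_zpowers z)))
    have e3 : u = x := inv_mul_eq_one.mp e2
    have e4 : v = z := by rw [e1] at e2; exact mul_inv_eq_one.mp e2
    exact hgen (x * z) (e3 ▸ hu.1) (e4 ▸ hv.1)

/-! ### Sections modulo a normal subgroup with cyclic quotient -/

theorem zpowers_eq_of_orderOf_eq {X : Type*} [Group X] [Finite X] [IsCyclic X] {x y : X}
    (h : orderOf x = orderOf y) : Subgroup.zpowers x = Subgroup.zpowers y := by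
  classical
  have := Fintype.ofFinite X
  have key : ∀ w : X, orderOf w = orderOf y →
      (Subgroup.zpowers w : Set X) = {a : X | a ^ orderOf y = 1} := by
    intro w hw
    refine Set.eq_of_subset_of_ncard_le ?_ ?_ (Set.toFinite _)
    · rintro _ ⟨i, rfl⟩
      change (w ^ i) ^ orderOf y = 1
      rw [← hw, ← zpow_natCast, ← zpow_mul, mul_comm, zpow_mul, zpow_natCast, pow_orderOf_eq_one,
        one_zpow]
    · have h1 := IsCyclic.card_pow_eq_one_le (α := X) (orderOf_pos y)
      rw [show (Subgroup.zpowers w : Set X).ncard = orderOf y from by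
        rw [← hw, ← Nat.card_zpowers]; rfl]
      rw [Set.ncard_eq_toFinset_card']
      simpa using h1
  exact SetLike.coe_injective ((key x h).trans (key y rfl).symm)

/-- A section `J / K` with `J ∩ O ≤ K`, where `G / O` is cyclic, is cyclic: elements of `J` with the
same order modulo `K` generate the same subgroup modulo `K`, so a subgroup containing `K` contains
both or neither. -/
theorem mem_of_isCyclic_quotient [Finite G] {O J K L : Subgroup G} [O.Normal] [IsCyclic (G ⧸ O)]
    (hJO : J ⊓ O ≤ K) {x y : G} (hx : x ∈ J) (hy : y ∈ J)
    (hxy : ∀ n : ℕ, x ^ n ∈ K ↔ y ^ n ∈ K) (hKL : K ≤ L) (hyL : y ∈ L) : x ∈ L := by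
  set f : J →* G ⧸ O := (QuotientGroup.mk' O).comp J.subtype
  have hmem : ∀ j : J, f j = 1 → (j : G) ∈ K := fun j hj =>
    hJO ⟨j.2, by simpa [f] using hj⟩
  have hfcomm : ∀ a b : G ⧸ O, a * b = b * a :=
    (IsCyclic.isMulCommutative (α := G ⧸ O)).is_comm.comm
  have hN : (K.subgroupOf J).Normal := by
    refine ⟨fun k hk j => ?_⟩
    have h1 := hmem (j * k * j⁻¹ * k⁻¹) (by
      rw [map_mul, map_mul, map_mul, hfcomm (f j), mul_assoc (f k), ← map_mul f j]
      simp)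
    have h2 := mul_mem h1 (Subgroup.mem_subgroupOf.mp hk)
    rw [Subgroup.mem_subgroupOf]
    simpa using h2
  have hcyc : IsCyclic (J ⧸ f.ker) :=
    isCyclic_of_injective (QuotientGroup.kerLift f) (QuotientGroup.kerLift_injective f)
  have hle : f.ker ≤ (K.subgroupOf J).comap (MonoidHom.id J) := fun j hj => hmem j hj
  have : IsCyclic (J ⧸ K.subgroupOf J) :=
    isCyclic_of_surjective (QuotientGroup.map f.ker (K.subgroupOf J) (MonoidHom.id J) hle)
      (QuotientGroup.map_surjective_of_surjective _ _ _
        ((QuotientGroup.mk'_surjective _).comp Function.surjective_id) hle)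
  have hord : orderOf ((⟨x, hx⟩ : J) : J ⧸ K.subgroupOf J) =
      orderOf ((⟨y, hy⟩ : J) : J ⧸ K.subgroupOf J) := by
    refine orderOf_eq_orderOf_iff.mpr fun n => ?_
    rw [← QuotientGroup.mk_pow, ← QuotientGroup.mk_pow, QuotientGroup.eq_one_iff,
      QuotientGroup.eq_one_iff, Subgroup.mem_subgroupOf, Subgroup.mem_subgroupOf]
    exact hxy n
  have hz := zpowers_eq_of_orderOf_eq hord
  obtain ⟨i, hi⟩ := (hz ▸ Subgroup.mem_zpowers _ :
    ((⟨x, hx⟩ : J) : J ⧸ K.subgroupOf J) ∈ Subgroup.zpowers ((⟨y, hy⟩ : J) : J ⧸ K.subgroupOf J))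
  have hi' : ((⟨y, hy⟩ ^ i : J) : J ⧸ K.subgroupOf J) = ((⟨x, hx⟩ : J) : J ⧸ K.subgroupOf J) := by
    simpa using hi
  have h5 := hKL (Subgroup.mem_subgroupOf.mp (QuotientGroup.eq.mp hi'))
  have h6 : (y ^ i)⁻¹ * x ∈ L := by simpa using h5
  simpa using mul_mem (zpow_mem hyL i) h6

/-- If `G / O` is cyclic and `L ∩ O` is central in `L` modulo `K`, then `L / K` is abelian. -/
theorem commutator_mem_of_isCyclic_quotient {O L K : Subgroup G} [O.Normal] [IsCyclic (G ⧸ O)]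
    (hK : ∀ x ∈ L, ∀ k ∈ K, x * k * x⁻¹ ∈ K)
    (hc : ∀ x ∈ L, ∀ a ∈ L ⊓ O, x⁻¹ * (a⁻¹ * x * a) ∈ K) {x y : G} (hx : x ∈ L) (hy : y ∈ L) :
    x⁻¹ * (y⁻¹ * x * y) ∈ K := by
  have hN : (K.subgroupOf L).Normal := ⟨fun k hk j => hK j j.2 k hk⟩
  set f : L →* G ⧸ O := (QuotientGroup.mk' O).comp L.subtype
  have hcyc : IsCyclic (L ⧸ f.ker) :=
    isCyclic_of_injective (QuotientGroup.kerLift f) (QuotientGroup.kerLift_injective f)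
  set q : L →* L ⧸ K.subgroupOf L := QuotientGroup.mk' _
  have hq : Function.Surjective q := QuotientGroup.mk'_surjective _
  have hle : f.ker ≤ (Subgroup.center (L ⧸ K.subgroupOf L)).comap q := by
    intro a ha
    rw [Subgroup.mem_comap, Subgroup.mem_center_iff]
    intro b
    obtain ⟨b, rfl⟩ := hq b
    rw [← map_mul, ← map_mul]
    refine (QuotientGroup.eq.mpr ?_).symm
    rw [Subgroup.mem_subgroupOf]
    have h1 := hc b b.2 a ⟨a.2, by simpa [f, MonoidHom.mem_ker] using ha⟩
    simpa [mul_assoc] using h1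
  have hcyc2 : IsCyclic ((L ⧸ K.subgroupOf L) ⧸ Subgroup.center (L ⧸ K.subgroupOf L)) :=
    isCyclic_of_surjective (QuotientGroup.map f.ker (Subgroup.center _) q hle)
      (QuotientGroup.map_surjective_of_surjective _ _ _
        ((QuotientGroup.mk'_surjective _).comp hq) hle)
  have hcomm := (MonoidHom.isMulCommutative_of_isCyclic_of_ker_le_center
    (QuotientGroup.mk' (Subgroup.center (L ⧸ K.subgroupOf L)))
    (by rw [QuotientGroup.ker_mk'])).is_comm.comm (q ⟨y, hy⟩) (q ⟨x, hx⟩)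
  rw [← map_mul, ← map_mul] at hcomm
  have := Subgroup.mem_subgroupOf.mp (QuotientGroup.eq.mp hcomm)
  simpa [mul_assoc] using this

/-! ### Operator-isomorphic sections with a common bottom -/

/-- `Γ` is the preimage in `H × L` of the graph of an `O`-isomorphism between the sections `H / K`
and `L / K`, on which `O` acts by conjugation. -/
structure SectionCorr (O K H L : Subgroup G) (Γ : Subgroup (G × G)) : Prop where
  le_left : K ≤ H
  le_right : K ≤ L
  conj_left : ∀ h ∈ H, ∀ k ∈ K, h * k * h⁻¹ ∈ K
  conj_right : ∀ l ∈ L, ∀ k ∈ K, l * k * l⁻¹ ∈ K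
  inv_bot : IsInvariantUnder O K
  inv_left : IsInvariantUnder O H
  inv_right : IsInvariantUnder O L
  mem : ∀ h l, (h, l) ∈ Γ → h ∈ H ∧ l ∈ L
  exists_right : ∀ h ∈ H, ∃ l, (h, l) ∈ Γ
  exists_left : ∀ l ∈ L, ∃ h, (h, l) ∈ Γ
  mem_iff : ∀ h l, (h, l) ∈ Γ → (h ∈ K ↔ l ∈ K)
  conj : ∀ a ∈ O, ∀ h l, (h, l) ∈ Γ → (a⁻¹ * h * a, a⁻¹ * l * a) ∈ Γ

theorem IsInvariantUnder.sup {O H K : Subgroup G} (hH : IsInvariantUnder O H)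
    (hK : IsInvariantUnder O K) : IsInvariantUnder O (H ⊔ K) := by
  rw [isInvariantUnder_iff] at *
  exact le_normalizer_sup hH hK

theorem IsInvariantUnder.inf {O H K : Subgroup G} (hH : IsInvariantUnder O H)
    (hK : IsInvariantUnder O K) : IsInvariantUnder O (H ⊓ K) :=
  fun a ha x hx => ⟨hH a ha x hx.1, hK a ha x hx.2⟩

theorem isInvariantUnder_self (O : Subgroup G) : IsInvariantUnder O O :=
  fun _ ha _ hx => mul_mem (mul_mem (inv_mem ha) hx) ha

theorem commutator_mem_of_isCyclic {O : Subgroup G} [O.Normal]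
    [IsCyclic (G ⧸ O)] (x y : G) : x * y * x⁻¹ * y⁻¹ ∈ O := by
  rw [← QuotientGroup.eq_one_iff]
  have h : ∀ a b : G ⧸ O, a * b = b * a :=
    (IsCyclic.isMulCommutative (α := G ⧸ O)).is_comm.comm
  simp only [QuotientGroup.mk_mul, QuotientGroup.mk_inv]
  rw [h x y]
  group

namespace SectionCorr

variable {O K H L : Subgroup G} {Γ : Subgroup (G × G)}

theorem symm (c : SectionCorr O K H L Γ) :
    SectionCorr O K L H (Γ.comap (MulEquiv.prodComm (M := G) (N := G)).toMonoidHom) where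
  le_left := c.le_right
  le_right := c.le_left
  conj_left := c.conj_right
  conj_right := c.conj_left
  inv_bot := c.inv_bot
  inv_left := c.inv_right
  inv_right := c.inv_left
  mem h l hl := (c.mem l h hl).symm
  exists_right := c.exists_left
  exists_left := c.exists_right
  mem_iff h l hl := (c.mem_iff l h hl).symm
  conj a ha h l hl := c.conj a ha l h hl

/-- The restriction of a correspondence to a section `H₁ / K` of `H / K`. -/
theorem restrict (c : SectionCorr O K H L Γ) {H₁ : Subgroup G} (h1 : K ≤ H₁) (h2 : H₁ ≤ H)
    (h3 : IsInvariantUnder O H₁) :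
    SectionCorr O K H₁ ((Γ ⊓ H₁.prod ⊤).map (MonoidHom.snd G G)) (Γ ⊓ H₁.prod ⊤) where
  le_left := h1
  le_right k hk := by
    obtain ⟨h, hh⟩ := c.exists_left k (c.le_right hk)
    exact ⟨(h, k), ⟨hh, h1 ((c.mem_iff _ _ hh).mpr hk), trivial⟩, rfl⟩
  conj_left h hh := c.conj_left h (h2 hh)
  conj_right := by
    rintro _ ⟨⟨h, l⟩, ⟨hl, -⟩, rfl⟩
    exact c.conj_right l (c.mem _ _ hl).2
  inv_bot := c.inv_bot
  inv_left := h3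
  inv_right := by
    rintro a ha _ ⟨⟨h, l⟩, ⟨hl, hh, -⟩, rfl⟩
    exact ⟨(a⁻¹ * h * a, a⁻¹ * l * a), ⟨c.conj a ha _ _ hl, h3 a ha _ hh, trivial⟩, rfl⟩
  mem h l hl := ⟨hl.2.1, (h, l), hl, rfl⟩
  exists_right h hh := by
    obtain ⟨l, hl⟩ := c.exists_right h (h2 hh)
    exact ⟨l, hl, hh, trivial⟩
  exists_left := by
    rintro _ ⟨⟨h, l⟩, hl, rfl⟩
    exact ⟨h, hl⟩
  mem_iff h l hl := c.mem_iff h l hl.1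
  conj a ha h l hl := ⟨c.conj a ha _ _ hl.1, h3 a ha _ hl.2.1, trivial⟩

theorem restrict_right_le (c : SectionCorr O K H L Γ) (H₁ : Subgroup G) :
    (Γ ⊓ H₁.prod ⊤).map (MonoidHom.snd G G) ≤ L := by
  rintro _ ⟨⟨h, l⟩, ⟨hl, -⟩, rfl⟩
  exact (c.mem _ _ hl).2

/-- If a normal `O`-invariant section `H₁ / K` of `H / K` corresponds to itself, there is a
correspondence between `H / H₁` and `L / H₁`. -/
theorem quotient (c : SectionCorr O K H L Γ) {H₁ : Subgroup G} (h1 : K ≤ H₁) (h2 : H₁ ≤ H)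
    (h3 : IsInvariantUnder O H₁) (h4 : ∀ h ∈ H, ∀ k ∈ H₁, h * k * h⁻¹ ∈ H₁)
    (h5 : (Γ ⊓ H₁.prod ⊤).map (MonoidHom.snd G G) = H₁) : SectionCorr O H₁ H L Γ where
  le_left := h2
  le_right := h5 ▸ c.restrict_right_le H₁
  conj_left := h4
  conj_right := by
    rw [← h5]
    rintro l hl _ ⟨⟨h', l'⟩, ⟨hl', hh', -⟩, rfl⟩
    obtain ⟨h, hh⟩ := c.exists_left l hl
    exact ⟨(h, l) * (h', l') * (h, l)⁻¹, ⟨Γ.mul_mem (Γ.mul_mem hh hl') (Γ.inv_mem hh),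
      h5.symm ▸ h4 h (c.mem _ _ hh).1 h' (h5 ▸ hh'), trivial⟩, rfl⟩
  inv_bot := h3
  inv_left := c.inv_left
  inv_right := c.inv_right
  mem := c.mem
  exists_right := c.exists_right
  exists_left := c.exists_left
  mem_iff h l hl := by
    constructor
    · intro hh
      rw [← h5]
      exact ⟨(h, l), ⟨hl, hh, trivial⟩, rfl⟩
    · intro hl1
      rw [← h5] at hl1
      obtain ⟨⟨h', l'⟩, ⟨hl', hh', -⟩, rfl⟩ := hl1
      have h6 : (h'⁻¹ * h, (1 : G)) ∈ Γ := by
        simpa using Γ.mul_mem (Γ.inv_mem hl') hl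
      have h7 := (c.mem_iff _ _ h6).mpr (one_mem _)
      simpa using mul_mem hh' (h1 h7)
  conj := c.conj

theorem relIndex_eq (c : SectionCorr O K H L Γ) : K.relIndex H = K.relIndex L := by
  have hH : Γ.map (MonoidHom.fst G G) = H := by
    ext h
    constructor
    · rintro ⟨⟨h, l⟩, hl, rfl⟩
      exact (c.mem _ _ hl).1
    · intro hh
      obtain ⟨l, hl⟩ := c.exists_right h hh
      exact ⟨(h, l), hl, rfl⟩
  have hL : Γ.map (MonoidHom.snd G G) = L := by
    ext l
    constructor
    · rintro ⟨⟨h, l⟩, hl, rfl⟩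
      exact (c.mem _ _ hl).2
    · intro hh
      obtain ⟨h, hl⟩ := c.exists_left l hh
      exact ⟨(h, l), hl, rfl⟩
  have hK : K.comap (MonoidHom.fst G G) ⊓ Γ = K.comap (MonoidHom.snd G G) ⊓ Γ := by
    ext ⟨h, l⟩
    simp only [Subgroup.mem_inf, Subgroup.mem_comap, MonoidHom.coe_fst, MonoidHom.coe_snd]
    exact and_congr_left fun hl => c.mem_iff h l hl
  rw [← hH, ← hL, ← Subgroup.relIndex_comap, ← Subgroup.relIndex_comap,
    ← Subgroup.inf_relIndex_right, hK, Subgroup.inf_relIndex_right]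

/-- The case `H = (H ∩ O) K`, `H ∩ L = K`. Here `L ∩ O` centralizes `H / K` and hence `L / K`, which
is therefore abelian; so `H ∩ O` centralizes `L / K`, the products of corresponding elements form
an `O`-invariant subgroup, and this subgroup meets `H` and `L` in `K`. -/
theorem le_of_le_sup [O.Normal] [IsCyclic (G ⧸ O)] (c : SectionCorr O K H L Γ) {U : Subgroup G}
    (W : JoinSplits fun A : Subgroup G => IsInvariantUnder O A ∧ A ≤ U) (hHU : H ≤ U)
    (hLU : L ≤ U) (hHL : H ⊓ L ≤ K) (hH : H ≤ (H ⊓ O) ⊔ K) : H ≤ K := by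
  have hperm : Permutes (H ⊓ O) K :=
    (permutes_of_le_normalizer (le_normalizer_of_forall (O := H ⊓ O) fun a ha x hx =>
      c.conj_left a ha.1 x hx)).symm
  have e1 : ∀ h l, (h, l) ∈ Γ → ∀ a ∈ L ⊓ O, l⁻¹ * (a⁻¹ * l * a) ∈ K := by
    intro h l hl a ha
    have h1 : (h⁻¹ * (a⁻¹ * h * a), l⁻¹ * (a⁻¹ * l * a)) ∈ Γ :=
      mul_mem (inv_mem hl) (c.conj a ha.2 _ _ hl)
    rw [← c.mem_iff _ _ h1]
    obtain ⟨h0, hh0, k, hk, rfl⟩ := hperm.mem_sup.mp (hH (c.mem _ _ hl).1)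
    have h2 : h0⁻¹ * (a⁻¹ * h0 * a) ∈ K := by
      refine hHL ⟨H.mul_mem (H.inv_mem hh0.1) (c.inv_left a ha.2 _ hh0.1), ?_⟩
      have := mul_mem (c.inv_right h0 hh0.2 _ (inv_mem ha.1)) ha.1
      simpa [mul_assoc] using this
    have h3 := mul_mem (mul_mem (inv_mem hk) h2) (c.inv_bot a ha.2 _ hk)
    convert h3 using 1
    group
  have e2 : ∀ x ∈ L, ∀ y ∈ L, x⁻¹ * (y⁻¹ * x * y) ∈ K := fun x hx y hy =>
    commutator_mem_of_isCyclic_quotient c.conj_right (fun x hx a ha => by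
      obtain ⟨h, hh⟩ := c.exists_left x hx
      exact e1 h x hh a ha) hx hy
  have e3 : ∀ h ∈ H ⊓ O, ∀ l ∈ L, l⁻¹ * (h⁻¹ * l * h) ∈ K := by
    intro h hh l hl
    obtain ⟨h', hh'⟩ := c.exists_left l hl
    obtain ⟨l', hl'⟩ := c.exists_right h hh.1
    have h1 : (h'⁻¹ * (h⁻¹ * h' * h), l⁻¹ * (h⁻¹ * l * h)) ∈ Γ :=
      mul_mem (inv_mem hh') (c.conj h hh.2 _ _ hh')
    have h2 : (h'⁻¹ * (h⁻¹ * h' * h), l⁻¹ * (l'⁻¹ * l * l')) ∈ Γ :=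
      mul_mem (inv_mem hh') (mul_mem (mul_mem (inv_mem hl') hh') hl')
    exact (c.mem_iff _ _ h1).mp ((c.mem_iff _ _ h2).mpr (e2 l hl l' (c.mem _ _ hl').2))
  let E : Subgroup G :=
    { carrier := {x | ∃ h l, h ∈ O ∧ (h, l) ∈ Γ ∧ (h * l)⁻¹ * x ∈ K}
      one_mem' := ⟨1, 1, one_mem _, one_mem _, by simp⟩
      mul_mem' := by
        rintro x x' ⟨h, l, hO, hl, hk⟩ ⟨h', l', hO', hl', hk'⟩
        refine ⟨h * h', l * l', mul_mem hO hO', mul_mem hl hl', ?_⟩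
        have h1 := mul_mem (e3 h' ⟨(c.mem _ _ hl').1, hO'⟩ l (c.mem _ _ hl).2)
          (c.inv_bot h' hO' _ hk)
        have h2 := c.conj_right _ (inv_mem (c.mem _ _ hl').2) _ h1
        have h3 := mul_mem h2 hk'
        convert h3 using 1
        group
      inv_mem' := by
        rintro x ⟨h, l, hO, hl, hk⟩
        refine ⟨h⁻¹, l⁻¹, inv_mem hO, inv_mem hl, ?_⟩
        have h1 := c.conj_right l (c.mem _ _ hl).2 _ (c.conj_left h (c.mem _ _ hl).1 _ (inv_mem hk))
        have h2 := e3 _ (inv_mem (show h ∈ H ⊓ O from ⟨(c.mem _ _ hl).1, hO⟩)) _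
          (inv_mem (c.mem _ _ hl).2)
        have h3 := mul_mem h1 h2
        convert h3 using 1
        group }
  have hEinv : IsInvariantUnder O E := by
    rintro a ha x ⟨h, l, hO, hl, hk⟩
    refine ⟨a⁻¹ * h * a, a⁻¹ * l * a, isInvariantUnder_self O a ha h hO, c.conj a ha _ _ hl, ?_⟩
    have := c.inv_bot a ha _ hk
    convert this using 1
    group
  have hEle : E ≤ H ⊔ L := by
    rintro x ⟨h, l, hO, hl, hk⟩
    have h1 := mul_mem (mul_mem (Subgroup.mem_sup_left (T := L) (c.mem _ _ hl).1)
      (Subgroup.mem_sup_right (c.mem _ _ hl).2)) (Subgroup.mem_sup_left (c.le_left hk))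
    rwa [mul_inv_cancel_left] at h1
  have hEK : E ≤ K := by
    refine (W E H L ⟨hEinv, hEle.trans (sup_le hHU hLU)⟩ ⟨c.inv_left, hHU⟩ ⟨c.inv_right, hLU⟩
      hEle).trans (sup_le ?_ ?_)
    · rintro x ⟨⟨h, l, hO, hl, hk⟩, hx⟩
      have hlK : l ∈ K := by
        refine hHL ⟨?_, (c.mem _ _ hl).2⟩
        have h1 := H.mul_mem (H.mul_mem (H.inv_mem (c.mem _ _ hl).1) hx) (H.inv_mem (c.le_left hk))
        have h2 : h⁻¹ * x * ((h * l)⁻¹ * x)⁻¹ = l := by group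
        rwa [h2] at h1
      have := mul_mem (mul_mem ((c.mem_iff _ _ hl).mpr hlK) hlK) hk
      rwa [mul_inv_cancel_left] at this
    · rintro x ⟨⟨h, l, hO, hl, hk⟩, hx⟩
      have hhK : h ∈ K := by
        refine hHL ⟨(c.mem _ _ hl).1, ?_⟩
        have h1 := L.mul_mem (L.mul_mem hx (L.inv_mem (c.le_right hk))) (L.inv_mem (c.mem _ _ hl).2)
        have h2 : x * ((h * l)⁻¹ * x)⁻¹ * l⁻¹ = h := by group
        rwa [h2] at h1
      have := mul_mem (mul_mem hhK ((c.mem_iff _ _ hl).mp hhK)) hk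
      rwa [mul_inv_cancel_left] at this
  refine hH.trans (sup_le (fun h hh => ?_) le_rfl)
  obtain ⟨l, hl⟩ := c.exists_right h hh.1
  have h1 : h * l ∈ K := hEK ⟨h, l, hh.2, hl, by simp⟩
  refine hHL ⟨hh.1, ?_⟩
  simpa using mul_mem (c.le_right h1) (inv_mem (c.mem _ _ hl).2)

/-- The previous case, applied to the restriction of the correspondence to `(H ∩ O) K / K`. -/
theorem inf_le [O.Normal] [IsCyclic (G ⧸ O)] (c : SectionCorr O K H L Γ) {U : Subgroup G}
    (W : JoinSplits fun A : Subgroup G => IsInvariantUnder O A ∧ A ≤ U) (hHU : H ≤ U)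
    (hLU : L ≤ U) (hHL : H ⊓ L ≤ K) : H ⊓ O ≤ K := by
  have hle : (H ⊓ O) ⊔ K ≤ H := sup_le inf_le_left c.le_left
  have c' := c.restrict (H₁ := (H ⊓ O) ⊔ K) le_sup_right hle
    ((c.inv_left.inf (isInvariantUnder_self O)).sup c.inv_bot)
  refine le_sup_left.trans (c'.le_of_le_sup W (hle.trans hHU) ((c.restrict_right_le _).trans hLU)
    ((inf_le_inf hle (c.restrict_right_le _)).trans hHL) ?_)
  exact sup_le_sup_right (_root_.le_inf le_sup_left inf_le_right) K

/-- If `H ∩ L = K`, then `HL / K` meets `O` trivially, hence is cyclic, and `H / K` and `L / K` have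
the same order. -/
theorem eq_of_inf_le [Finite G] [O.Normal] [IsCyclic (G ⧸ O)] (c : SectionCorr O K H L Γ)
    {U : Subgroup G} (W : JoinSplits fun A : Subgroup G => IsInvariantUnder O A ∧ A ≤ U)
    (hHU : H ≤ U) (hLU : L ≤ U) (hHL : H ⊓ L ≤ K) : H = L := by
  have hJ : (H ⊔ L) ⊓ O ≤ K := by
    refine (W _ H L ⟨(c.inv_left.sup c.inv_right).inf (isInvariantUnder_self O),
      inf_le_left.trans (sup_le hHU hLU)⟩ ⟨c.inv_left, hHU⟩ ⟨c.inv_right, hLU⟩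
      inf_le_left).trans (sup_le ?_ ?_)
    · exact (_root_.le_inf inf_le_right (inf_le_left.trans inf_le_right)).trans
        (c.inf_le W hHU hLU hHL)
    · exact (_root_.le_inf inf_le_right (inf_le_left.trans inf_le_right)).trans
        (c.symm.inf_le W hLU hHU (by rwa [inf_comm]))
  have hpow : ∀ h l, (h, l) ∈ Γ → ∀ n : ℕ, h ^ n ∈ K ↔ l ^ n ∈ K := fun h l hl n =>
    c.mem_iff _ _ (pow_mem hl n)
  apply le_antisymm
  · intro h hh
    obtain ⟨l, hl⟩ := c.exists_right h hh
    exact mem_of_isCyclic_quotient hJ (Subgroup.mem_sup_left hh)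
      (Subgroup.mem_sup_right (c.mem _ _ hl).2) (hpow h l hl) c.le_right (c.mem _ _ hl).2
  · intro l hh
    obtain ⟨h, hl⟩ := c.exists_left l hh
    exact mem_of_isCyclic_quotient hJ (Subgroup.mem_sup_right hh)
      (Subgroup.mem_sup_left (c.mem _ _ hl).1) (fun n => (hpow h l hl n).symm) c.le_left
      (c.mem _ _ hl).1

/-- Operator-isomorphic sections with a common bottom coincide when the invariant subgroups form a
distributive lattice. By induction along a normal invariant subgroup strictly between `K` and `H`,
one may assume that there is none; then `H ∩ L` is `K` or `H`. -/
theorem eq [Finite G] [O.Normal] [IsCyclic (G ⧸ O)] (c : SectionCorr O K H L Γ)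
    {U : Subgroup G} (W : JoinSplits fun A : Subgroup G => IsInvariantUnder O A ∧ A ≤ U)
    (hHU : H ≤ U) (hLU : L ≤ U) : H = L := by
  obtain ⟨n, hn⟩ : ∃ n, K.relIndex H = n := ⟨_, rfl⟩
  induction n using Nat.strong_induction_on generalizing K H L Γ with
  | _ n ih =>
    by_cases hex : ∃ H₁, K ≤ H₁ ∧ H₁ ≤ H ∧ IsInvariantUnder O H₁ ∧
        (∀ h ∈ H, ∀ k ∈ H₁, h * k * h⁻¹ ∈ H₁) ∧ ¬ H₁ ≤ K ∧ ¬ H ≤ H₁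
    · obtain ⟨H₁, h1, h2, h3, h4, h5, h6⟩ := hex
      have hmul := Subgroup.relIndex_mul_relIndex K H₁ H h1 h2
      have hp : 0 < K.relIndex H₁ := Nat.pos_of_ne_zero Subgroup.index_ne_zero_of_finite
      have hq : 0 < H₁.relIndex H := Nat.pos_of_ne_zero Subgroup.index_ne_zero_of_finite
      have hp1 : K.relIndex H₁ ≠ 1 := fun e => h5 (Subgroup.relIndex_eq_one.mp e)
      have hq1 : H₁.relIndex H ≠ 1 := fun e => h6 (Subgroup.relIndex_eq_one.mp e)
      have e1 := ih (K.relIndex H₁)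
        (by rw [← hn, ← hmul]; nlinarith [show 2 ≤ H₁.relIndex H by omega])
        (c.restrict h1 h2 h3) (h2.trans hHU) ((c.restrict_right_le _).trans hLU) rfl
      exact ih (H₁.relIndex H) (by rw [← hn, ← hmul]; nlinarith [show 2 ≤ K.relIndex H₁ by omega])
        (c.quotient h1 h2 h3 h4 e1.symm) hHU hLU rfl
    · push Not at hex
      have hN : H ≤ Subgroup.normalizer ((H ⊓ L : Subgroup G) : Set G) := by
        by_cases hHO : (H ⊓ O) ⊔ K ≤ K
        · refine le_normalizer_of_forall fun h hh i hi => ?_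
          have h1 : h * i * h⁻¹ * i⁻¹ ∈ H ⊓ O :=
            ⟨H.mul_mem (H.mul_mem (H.mul_mem hh hi.1) (H.inv_mem hh)) (H.inv_mem hi.1),
              commutator_mem_of_isCyclic h i⟩
          have h2 := (le_sup_left.trans hHO) h1
          simpa using mul_mem (_root_.le_inf c.le_left c.le_right h2) hi
        · have h1 := hex ((H ⊓ O) ⊔ K) le_sup_right (sup_le inf_le_left c.le_left)
            ((c.inv_left.inf (isInvariantUnder_self O)).sup c.inv_bot)
            (fun h hh k hk => conj_mem_of_le_normalizer
              (le_normalizer_sup (le_normalizer_inf Subgroup.le_normalizer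
                Subgroup.le_normalizer_of_normal)
                (le_normalizer_of_forall c.conj_left)) hh hk) hHO
          refine h1.trans (sup_le (inf_le_right.trans ?_)
            ((_root_.le_inf c.le_left c.le_right).trans Subgroup.le_normalizer))
          exact isInvariantUnder_iff.mp (c.inv_left.inf c.inv_right)
      by_cases hHL : H ⊓ L ≤ K
      · exact c.eq_of_inf_le W hHU hLU hHL
      · have h1 := hex (H ⊓ L) (_root_.le_inf c.le_left c.le_right) inf_le_left
          (c.inv_left.inf c.inv_right)
          (fun h hh k hk => conj_mem_of_le_normalizer hN hh hk) hHL
        have h2 : H ≤ L := h1.trans inf_le_right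
        have h3 := Subgroup.relIndex_mul_relIndex K H L c.le_left h2
        rw [← c.relIndex_eq] at h3
        have hp : 0 < K.relIndex H := Nat.pos_of_ne_zero Subgroup.index_ne_zero_of_finite
        exact le_antisymm h2 (Subgroup.relIndex_eq_one.mp
          (Nat.eq_of_mul_eq_mul_left hp (h3.trans (mul_one _).symm)))

end SectionCorr

/-- The preimage in `H × L` of the graph of an operator isomorphism of sections. -/
theorem AreOperatorIsomorphic.exists_sectionCorr {O H L K : Subgroup G}
    (h : AreOperatorIsomorphic O H L K) : ∃ Γ, SectionCorr O K H L Γ := by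
  obtain ⟨⟨hKH, hKH', hOH, hOK⟩, ⟨hKL, hKL', hOL, -⟩, hN1, hN2, φ, hφ⟩ := h
  have hconj : ∀ {M : Subgroup G}, K ≤ M → (K.subgroupOf M).Normal →
      ∀ m ∈ M, ∀ k ∈ K, m * k * m⁻¹ ∈ K := fun hM hN m hm k hk =>
    (Subgroup.normal_subgroupOf_iff hM).mp hN k m hk hm
  let Γ : Subgroup (G × G) :=
    { carrier := {p | ∃ (h1 : p.1 ∈ H) (h2 : p.2 ∈ L),
        φ ((⟨p.1, h1⟩ : H) : H ⧸ K.subgroupOf H) = ((⟨p.2, h2⟩ : L) : L ⧸ K.subgroupOf L)}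
      one_mem' := ⟨one_mem H, one_mem L, map_one φ⟩
      mul_mem' := by
        rintro p q ⟨h1, h2, h3⟩ ⟨h1', h2', h3'⟩
        refine ⟨mul_mem h1 h1', mul_mem h2 h2', ?_⟩
        have := congrArg₂ (· * ·) h3 h3'
        rwa [← map_mul] at this
      inv_mem' := by
        rintro p ⟨h1, h2, h3⟩
        refine ⟨inv_mem h1, inv_mem h2, ?_⟩
        have := congrArg (·⁻¹) h3
        rwa [← map_inv] at this }
  refine ⟨Γ, hKH, hKL, hconj hKH hKH', hconj hKL hKL', hOK, hOH, hOL, ?_, ?_, ?_, ?_, ?_⟩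
  · rintro h l ⟨h1, h2, -⟩
    exact ⟨h1, h2⟩
  · intro h hh
    obtain ⟨l, hl⟩ := QuotientGroup.mk_surjective (φ ((⟨h, hh⟩ : H) : H ⧸ K.subgroupOf H))
    exact ⟨l, hh, l.2, hl.symm⟩
  · intro l hl
    obtain ⟨h, hh⟩ := QuotientGroup.mk_surjective (φ.symm ((⟨l, hl⟩ : L) : L ⧸ K.subgroupOf L))
    exact ⟨h, h.2, hl, by rw [Subtype.coe_eta, hh]; exact φ.apply_symm_apply _⟩
  · rintro h l ⟨h1, h2, h3⟩
    have e1 := QuotientGroup.eq_one_iff (N := K.subgroupOf H) (⟨h, h1⟩ : H)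
    have e2 := QuotientGroup.eq_one_iff (N := K.subgroupOf L) (⟨l, h2⟩ : L)
    rw [Subgroup.mem_subgroupOf] at e1 e2
    rw [← e1, ← e2, ← h3]
    exact (map_eq_one_iff φ φ.injective).symm
  · rintro a ha h l ⟨h1, h2, h3⟩
    exact ⟨hOH a ha h h1, hOL a ha l h2, hφ a ha ⟨h, h1⟩ ⟨_, hOH a ha h h1⟩ ⟨l, h2⟩
      ⟨_, hOL a ha l h2⟩ rfl rfl h3⟩

/-! ### Consequences of distributivity -/

theorem HasHall.isSigmaFull [Finite G] (h : HasHall π G) : IsSigmaFull (sigmaPi π) G := by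
  obtain ⟨⟨P, hP⟩, Q, hQ⟩ := h
  have key : ∀ {τ : Set Nat.Primes} {H : Subgroup G}, IsHall τ H → IsHall τᶜ H →
      ¬ ∃ p ∈ τ, (p : ℕ) ∣ Nat.card G := by
    rintro τ H h1 h2 ⟨p, hp, hdvd⟩
    refine IsPiNumber.of_dvd (π := τᶜ) ?_ hdvd p dvd_rfl hp
    rw [← Subgroup.card_mul_index H]
    exact IsPiNumber.mul h2.1 h1.2
  refine ⟨{P, Q}, ?_, ?_⟩
  · rintro H (rfl | rfl) -
    exacts [⟨true, hP⟩, ⟨false, hQ⟩]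
  · rintro (_ | _) hi
    · refine ⟨Q, ⟨by simp, hQ⟩, ?_⟩
      rintro H ⟨rfl | rfl, hH⟩
      · exact (key (τ := πᶜ) hH (by rwa [compl_compl]) hi).elim
      · rfl
    · refine ⟨P, ⟨by simp, hP⟩, ?_⟩
      rintro H ⟨rfl | rfl, hH⟩
      · rfl
      · exact (key (τ := π) hH hQ hi).elim

theorem isSigmaPermutable_iff [Finite G] (hG : HasHall π G) {A : Subgroup G} :
    IsSigmaPermutable (sigmaPi π) A ↔ HallPerm π A :=
  ⟨fun h => ⟨h.2 true, h.2 false⟩, fun h => ⟨hG.isSigmaFull, by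
    rintro (_ | _)
    exacts [h.2, h.1]⟩⟩

theorem isCyclic_quotient_residual [Finite G] (hG : HasHall π G)
    (W : JoinSplits (HallPerm π (G := G))) : IsCyclic (G ⧸ piDecomposableResidual π G) :=
  isCyclic_of_joinSplits (W.quotient _ fun A _ => hallPerm_of_residual_le hG
    (by simpa using (Subgroup.comap_mono (f := QuotientGroup.mk' _) (bot_le : ⊥ ≤ A))))

theorem isCyclic_quotient_piResidual [Finite G] (hG : HasHall π G)
    (h : IsCyclic (G ⧸ piDecomposableResidual π G)) : IsCyclic (G ⧸ piResidual π G) := by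
  have hle : piDecomposableResidual π G ≤ piResidual π G := by
    rw [piDecomposableResidual_eq hG]
    exact inf_le_left
  have hle' : piDecomposableResidual π G ≤ (piResidual π G).comap (MonoidHom.id G) := hle
  exact isCyclic_of_surjective (QuotientGroup.map _ (piResidual π G) (MonoidHom.id G) hle')
    (QuotientGroup.map_surjective_of_surjective _ _ _
      ((QuotientGroup.mk'_surjective _).comp Function.surjective_id) hle')

/-- With `D` the residual, `ba = ab c` where `c ∈ D ∩ ⟨A, B⟩ = (D ∩ A)(D ∩ B)`, and `D` normalizes
both `A` and `B`. -/
theorem permutes_of_joinSplits [Finite G] (hG : HasHall π G)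
    (W : JoinSplits (HallPerm π (G := G))) {A B : Subgroup G} (hA : HallPerm π A)
    (hB : HallPerm π B) : Permutes A B := by
  set D := piDecomposableResidual π G
  have := isCyclic_quotient_residual hG W
  have hDA : D ≤ Subgroup.normalizer (A : Set G) := hA.residual_le_normalizer hG
  have hDB : D ≤ Subgroup.normalizer (B : Set G) := hB.residual_le_normalizer hG
  refine permutes_of_subset fun b hb a ha => ?_
  have h1 : b⁻¹ * a⁻¹ * b⁻¹⁻¹ * a⁻¹⁻¹ ∈ (A ⊔ B) ⊓ D := by
    refine ⟨?_, commutator_mem_of_isCyclic _ _⟩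
    have ha' : a ∈ A ⊔ B := Subgroup.mem_sup_left ha
    have hb' : b ∈ A ⊔ B := Subgroup.mem_sup_right hb
    exact (A ⊔ B).mul_mem ((A ⊔ B).mul_mem ((A ⊔ B).mul_mem (inv_mem hb') (inv_mem ha'))
      (inv_mem (inv_mem hb'))) (inv_mem (inv_mem ha'))
  have h2 := W _ A B ((hA.sup hB).inf_normal D) hA hB inf_le_left h1
  have h3 : (A ⊔ B) ⊓ D ⊓ A ⊔ (A ⊔ B) ⊓ D ⊓ B ≤ (D ⊓ B) ⊔ (D ⊓ A) :=
    sup_le ((inf_le_inf_right A inf_le_right).trans le_sup_right)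
      ((inf_le_inf_right B inf_le_right).trans le_sup_left)
  have hperm : Permutes (D ⊓ B) (D ⊓ A) :=
    permutes_of_le_normalizer (le_normalizer_inf
      (Subgroup.le_normalizer_of_normal) (inf_le_left.trans hDB))
  obtain ⟨y, hy, x, hx, e⟩ := hperm.mem_sup.mp (h3 h2)
  refine ⟨a * x, mul_mem ha hx.2, x⁻¹ * (b * y) * x⁻¹⁻¹,
    conj_mem_of_le_normalizer hDB (inv_mem hx.1) (mul_mem hb hy.2), ?_⟩
  have e2 : b * a = a * b * (b⁻¹ * a⁻¹ * b⁻¹⁻¹ * a⁻¹⁻¹) := by group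
  rw [e2, e]
  group

theorem eq_of_areOperatorIsomorphic [Finite G] (hG : HasHall π G)
    (W : JoinSplits (HallPerm π (G := G))) {K H L : Subgroup G} (hH : HallPerm π H)
    (hL : HallPerm π L) (hH' : IsPiGroup π H) (hL' : IsPiGroup π L)
    (h : AreOperatorIsomorphic (piResidual π G) H L K) : H = L := by
  have := isCyclic_quotient_piResidual hG (isCyclic_quotient_residual hG W)
  obtain ⟨Γ, c⟩ := h.exists_sectionCorr
  have hp : ∀ A : Subgroup G, IsInvariantUnder (piResidual π G) A ∧ A ≤ H ⊔ L → HallPerm π A :=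
    fun A hA => hallPerm_of_le_hall hG
      (fun P hP => hA.2.trans (sup_le (hH.le_hall hH' hP) (hL.le_hall hL' hP)))
      (isInvariantUnder_iff.mp hA.1)
  exact c.eq (U := H ⊔ L) (fun A B C hA hB hC => W A B C (hp A hA) (hp B hB) (hp C hC))
    le_sup_left le_sup_right

theorem JoinSplits.hallPerm_quotient (W : JoinSplits (HallPerm π (G := G))) (R : Subgroup G)
    [R.Normal] : JoinSplits (HallPerm π (G := G ⧸ R)) :=
  W.quotient R fun _ hA => hA.comap (QuotientGroup.mk'_surjective R)

theorem IsPiSeparable.hasHall [Finite G] (hG : IsPiSeparable π G) : HasHall π G :=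
  ⟨hG.exists_hall, hG.compl.exists_hall⟩

theorem isomorphicSectionsCoincide_of_joinSplits [Finite G] (hG : IsPiSeparable π G)
    (W : JoinSplits (HallPerm π (G := G))) :
    IsomorphicSectionsCoincide (sigmaPi π) π G ∧ IsomorphicSectionsCoincide (sigmaPi π) πᶜ G := by
  constructor
  · intro R _ K H L hK hH hL hK' hH' hL' h
    have hG' := hG.hasHall.quotient R
    rw [isSigmaPermutable_iff hG'] at hH hL
    exact eq_of_areOperatorIsomorphic hG' (W.hallPerm_quotient R) hH hL hH' hL' h
  · intro R _ K H L hK hH hL hK' hH' hL' h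
    have hG' := hG.hasHall.quotient R
    rw [isSigmaPermutable_iff hG'] at hH hL
    have W' : JoinSplits (HallPerm πᶜ (G := G ⧸ R)) := fun A B C hA hB hC =>
      W.hallPerm_quotient R A B C (hallPerm_compl_iff.mp hA) (hallPerm_compl_iff.mp hB)
        (hallPerm_compl_iff.mp hC)
    exact eq_of_areOperatorIsomorphic hG'.compl W' hH.compl hL.compl hH' hL' h

/-! ### Perspective sections -/

/-- Sections `H / K` and `L / K` with a common complement `E / K` in `HE / K = LE / K` are
operator-isomorphic: both are mapped isomorphically onto `HE / E`. -/
theorem areOperatorIsomorphic_of_perspective {O H L E K : Subgroup G} (hKH : K ≤ H) (hKL : K ≤ L)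
    (hKE : K ≤ E) (hHK : H ≤ Subgroup.normalizer (K : Set G))
    (hLK : L ≤ Subgroup.normalizer (K : Set G)) (hHE : H ≤ Subgroup.normalizer (E : Set G))
    (hOK : O ≤ Subgroup.normalizer (K : Set G)) (hOH : O ≤ Subgroup.normalizer (H : Set G))
    (hOL : O ≤ Subgroup.normalizer (L : Set G)) (hOE : O ≤ Subgroup.normalizer (E : Set G))
    (h1 : H ⊓ E ≤ K) (h2 : L ⊓ E ≤ K) (h3 : H ≤ L ⊔ E) (h4 : L ≤ H ⊔ E) :
    AreOperatorIsomorphic O H L K := by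
  have hNH : (K.subgroupOf H).Normal := (Subgroup.normal_subgroupOf_iff_le_normalizer hKH).mpr hHK
  have hNL : (K.subgroupOf L).Normal := (Subgroup.normal_subgroupOf_iff_le_normalizer hKL).mpr hLK
  have hNE : (E.subgroupOf (H ⊔ E)).Normal :=
    (Subgroup.normal_subgroupOf_iff_le_normalizer le_sup_right).mpr
      (sup_le hHE Subgroup.le_normalizer)
  rw [← isInvariantUnder_iff] at hOK hOH hOL hOE
  refine ⟨⟨hKH, hNH, hOH, hOK⟩, ⟨hKL, hNL, hOL, hOK⟩, hNH, hNL, ?_⟩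
  have key : ∀ {X : Subgroup G} (hX : X ≤ H ⊔ E) (_ : K ≤ X) (_ : X ⊓ E ≤ K) (_ : H ≤ X ⊔ E)
      (_ : (K.subgroupOf X).Normal), ∃ e : (X ⧸ K.subgroupOf X) ≃* ((H ⊔ E : Subgroup G) ⧸
        E.subgroupOf (H ⊔ E)), ∀ x : X, e x = ((⟨x, hX x.2⟩ : (H ⊔ E : Subgroup G)) :
          (H ⊔ E : Subgroup G) ⧸ E.subgroupOf (H ⊔ E)) := by
    intro X hX hKX hXE hHX hN
    set f : X →* (H ⊔ E : Subgroup G) ⧸ E.subgroupOf (H ⊔ E) :=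
      (QuotientGroup.mk' _).comp (Subgroup.inclusion hX) with hf
    have hker : K.subgroupOf X = f.ker := by
      ext x
      rw [MonoidHom.mem_ker, Subgroup.mem_subgroupOf, hf, MonoidHom.comp_apply,
        QuotientGroup.mk'_apply, QuotientGroup.eq_one_iff, Subgroup.mem_subgroupOf]
      exact ⟨fun h => hKE h, fun h => hXE ⟨x.2, h⟩⟩
    have hsurj : Function.Surjective f := by
      intro q
      obtain ⟨⟨t, ht⟩, rfl⟩ := QuotientGroup.mk_surjective q
      have hXE' : X ≤ Subgroup.normalizer (E : Set G) :=
        hX.trans (sup_le hHE Subgroup.le_normalizer)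
      have hperm : Permutes X E := (permutes_of_le_normalizer hXE').symm
      obtain ⟨x, hx, e, he, rfl⟩ := hperm.mem_sup.mp ((sup_le hHX le_sup_right) ht)
      refine ⟨⟨x, hx⟩, ?_⟩
      refine QuotientGroup.eq.mpr ?_
      rw [Subgroup.mem_subgroupOf]
      simpa using he
    exact ⟨(QuotientGroup.quotientMulEquivOfEq hker).trans
      (QuotientGroup.quotientKerEquivOfSurjective f hsurj), fun x => rfl⟩
  obtain ⟨eH, heH⟩ := key le_sup_left hKH h1 le_sup_left hNH
  obtain ⟨eL, heL⟩ := key h4 hKL h2 h3 hNL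
  have hiff : ∀ (h : H) (l : L), (eH.trans eL.symm) (h : H ⧸ K.subgroupOf H) =
      (l : L ⧸ K.subgroupOf L) ↔ (h : G)⁻¹ * l ∈ E := by
    intro h l
    rw [MulEquiv.trans_apply, MulEquiv.symm_apply_eq, heH, heL, QuotientGroup.eq,
      Subgroup.mem_subgroupOf]
    rfl
  refine ⟨eH.trans eL.symm, fun a ha h h' l l' hh' hl' hφ => ?_⟩
  rw [hiff] at hφ ⊢
  have := hOE a ha _ hφ
  rw [hh', hl']
  convert this using 1
  group

/-! ### Abelian sections -/

theorem mul_pow_mem_iff {J M : Subgroup G}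
    (hc : ∀ x ∈ J, ∀ y ∈ J, x * y * x⁻¹ * y⁻¹ ∈ M) {x y : G} (hx : x ∈ J) (hy : y ∈ J) (n : ℕ) :
    (x * y) ^ n ∈ M ↔ x ^ n * y ^ n ∈ M := by
  have hN : (M.subgroupOf J).Normal :=
    ⟨fun k hk j => by
      rw [Subgroup.mem_subgroupOf] at hk ⊢
      simpa using mul_mem (hc j j.2 k k.2) hk⟩
  set q := QuotientGroup.mk' (M.subgroupOf J)
  have hcomm : Commute (q ⟨x, hx⟩) (q ⟨y, hy⟩) := by
    rw [commute_iff_eq, ← map_mul, ← map_mul]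
    refine QuotientGroup.eq.mpr ?_
    rw [Subgroup.mem_subgroupOf]
    have := hc y⁻¹ (inv_mem hy) x⁻¹ (inv_mem hx)
    simpa [mul_assoc] using this
  have hq : ∀ z : J, q z = 1 ↔ (z : G) ∈ M := fun z => by
    rw [QuotientGroup.mk'_apply, QuotientGroup.eq_one_iff, Subgroup.mem_subgroupOf]
  have h1 := hq ((⟨x, hx⟩ * ⟨y, hy⟩) ^ n)
  have h2 := hq (⟨x, hx⟩ ^ n * ⟨y, hy⟩ ^ n)
  rw [map_pow, map_mul, hcomm.mul_pow] at h1
  rw [map_mul, map_pow, map_pow] at h2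
  simpa using h1.symm.trans h2

theorem mem_of_pow_mem_of_coprime {M : Subgroup G} {y : G} {m n : ℕ} (h : m.Coprime n)
    (hm : y ^ m ∈ M) (hn : y ^ n ∈ M) : y ∈ M := by
  have h1 : y = (y ^ m) ^ (m.gcdA n) * (y ^ n) ^ (m.gcdB n) := by
    rw [← zpow_natCast y m, ← zpow_natCast y n, ← zpow_mul, ← zpow_mul, ← zpow_add,
      ← Nat.gcd_eq_gcd_ab, h.gcd_eq_one]
    simp
  rw [h1]
  exact mul_mem (zpow_mem hm _) (zpow_mem hn _)

theorem pow_relIndex_mem {M Z : Subgroup G} (h : Z ≤ Subgroup.normalizer (M : Set G)) {y : G}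
    (hy : y ∈ Z) : y ^ (M.relIndex Z) ∈ M := by
  have hN : (M.subgroupOf Z).Normal := by
    refine ⟨fun k hk j => ?_⟩
    rw [Subgroup.mem_subgroupOf] at hk ⊢
    exact conj_mem_of_le_normalizer h j.2 hk
  have := (M.subgroupOf Z).pow_index_mem ⟨y, hy⟩
  rw [Subgroup.mem_subgroupOf] at this
  exact this

theorem le_normalizer_of_commutator_mem {J M X : Subgroup G}
    (hc : ∀ x ∈ J, ∀ y ∈ J, x * y * x⁻¹ * y⁻¹ ∈ M) (hMX : M ≤ X) (hXJ : X ≤ J) :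
    J ≤ Subgroup.normalizer (X : Set G) :=
  le_normalizer_of_forall fun x hx y hy => by
    simpa using mul_mem (hMX (hc x hx y (hXJ hy))) hy

/-- If `A / M` is abelian, then `M (A ∩ P) / M` is its Hall `π`-subgroup, for every Hall
`π`-subgroup `P` of `G`. -/
theorem HallPerm.mem_sup_inf_hall_iff [Finite G] {A M P : Subgroup G} (hA : HallPerm π A)
    (hMA : M ≤ A) (hc : ∀ x ∈ A, ∀ y ∈ A, x * y * x⁻¹ * y⁻¹ ∈ M) (hP : IsHall π P) {a : G} :
    a ∈ M ⊔ (A ⊓ P) ↔ a ∈ A ∧ ∃ n, IsPiNumber π n ∧ a ^ n ∈ M := by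
  have hT : M ⊔ (A ⊓ P) ≤ A := sup_le hMA inf_le_left
  constructor
  · intro ha
    refine ⟨hT ha, Nat.card P, hP.1, ?_⟩
    have hperm : Permutes M (A ⊓ P) :=
      permutes_of_le_normalizer (inf_le_left.trans
        (le_normalizer_of_commutator_mem hc le_rfl hMA))
    obtain ⟨m, hm, p, hp, rfl⟩ := hperm.mem_sup.mp ha
    rw [mul_pow_mem_iff hc (hMA hm) hp.1]
    have h1 : p ^ Nat.card P = 1 := orderOf_dvd_iff_pow_eq_one.mp (Subgroup.orderOf_dvd_natCard P hp.2)
    rw [h1, mul_one]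
    exact pow_mem hm _
  · rintro ⟨ha, n, hn, han⟩
    refine mem_of_pow_mem_of_coprime (hn.coprime ?_) (Subgroup.mem_sup_left han)
      (pow_relIndex_mem (le_normalizer_of_commutator_mem hc le_sup_left hT) ha)
    have h1 := (hA.1 P hP).relIndex_hall hP
    rw [← Subgroup.inf_relIndex_left] at h1
    exact h1.of_dvd (Subgroup.relIndex_dvd_of_le_left _ le_sup_right)

theorem HallPerm.sup_inf_hall [Finite G] {A M P : Subgroup G} (hA : HallPerm π A)
    (hM : HallPerm π M) (hMA : M ≤ A) (hc : ∀ x ∈ A, ∀ y ∈ A, x * y * x⁻¹ * y⁻¹ ∈ M)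
    (hP : IsHall π P) : HallPerm π (M ⊔ (A ⊓ P)) := by
  have heq : ∀ P', IsHall π P' → M ⊔ (A ⊓ P) = M ⊔ (A ⊓ P') := fun P' hP' => by
    ext a
    rw [hA.mem_sup_inf_hall_iff hMA hc hP, hA.mem_sup_inf_hall_iff hMA hc hP']
  constructor
  · intro P' hP'
    rw [heq P' hP']
    have hperm : Permutes M (A ⊓ P') :=
      permutes_of_le_normalizer (inf_le_left.trans
        (le_normalizer_of_commutator_mem hc le_rfl hMA))
    refine permutes_of_subset fun y hy x hx => ?_
    obtain ⟨m, hm, p, hp, rfl⟩ := hperm.mem_sup.mp hx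
    obtain ⟨m', hm', y', hy', e⟩ := (hM.1 P' hP').exists_mul hm hy
    exact ⟨m', Subgroup.mem_sup_left hm', y' * p, mul_mem hy' hp.2, by
      rw [← mul_assoc, e, mul_assoc]⟩
  · intro Q hQ
    have h1 : M ⊔ (A ⊓ P) = M ⊔ hallJoin π A := by
      refine le_antisymm (sup_le_sup_left (inf_le_hallJoin A hP) M)
        (sup_le le_sup_left (sSup_le ?_))
      rintro _ ⟨P', hP', rfl⟩
      rw [heq P' hP']
      exact le_sup_right
    rw [h1]
    exact (hM.2 Q hQ).sup (permutes_of_le_normalizer (hA.le_normalizer_hallJoin' hQ))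

/-! ### Diamonds -/

/-- As `hallJoin πᶜ M` is normalized by `O^π'(G)` and `G = Q O^π'(G)`, its normal closure is
generated by its conjugates under `Q`. -/
theorem HallPerm.normalClosure_le [Finite G] (hG : HasHall π G) {M Q : Subgroup G}
    (hM : HallPerm π M) (hQ : IsHall πᶜ Q) :
    Subgroup.normalClosure (hallJoin πᶜ M : Set G) ≤ M ⊔ Q := by
  refine (Subgroup.closure_le _).mpr ?_
  intro x hx
  obtain ⟨y, hy, hyx⟩ := Group.mem_conjugatesOfSet_iff.mp hx
  obtain ⟨g, rfl⟩ := isConj_iff.mp hyx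
  obtain ⟨q, hq, o, ho, rfl⟩ := exists_mul_of_isPiNumber_relIndex (π := π) (X := Q)
    (Y := piResidual πᶜ G) (Z := ⊤) le_top le_top
    (by rw [Subgroup.relIndex_top_right]; simpa using hQ.2)
    (by rw [Subgroup.relIndex_top_right]; exact piResidual_index hG.compl) g trivial
  have h1 := conj_mem_of_le_normalizer (hM.piResidual_compl_le_normalizer_hallJoin hG) ho hy
  have h2 : q * (o * y * o⁻¹) * q⁻¹ ∈ M ⊔ Q :=
    mul_mem (mul_mem (Subgroup.mem_sup_right hq) (Subgroup.mem_sup_left (hallJoin_le _ _ h1)))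
      (inv_mem (Subgroup.mem_sup_right hq))
  have h3 : q * o * y * (q * o)⁻¹ = q * (o * y * o⁻¹) * q⁻¹ := by group
  rw [SetLike.mem_coe, h3]
  exact h2

/-- `A / M`, `B / M`, `C / M` are the three middle terms of a diamond with bottom `M` inside a section
`J / M` that is abelian. Of the conditions on joins, `A ≤ ⟨B, C⟩` and `B ≤ ⟨A, C⟩` are enough. -/
structure IsAbelianDiamond (A B C M J : Subgroup G) : Prop where
  bot_le₁ : M ≤ A
  bot_le₂ : M ≤ B
  bot_le₃ : M ≤ C
  le_top₁ : A ≤ J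
  le_top₂ : B ≤ J
  le_top₃ : C ≤ J
  inf_le₁₂ : A ⊓ B ≤ M
  inf_le₁₃ : A ⊓ C ≤ M
  inf_le₂₃ : B ⊓ C ≤ M
  le_sup₁ : A ≤ B ⊔ C
  le_sup₂ : B ≤ A ⊔ C
  commutator_mem : ∀ x ∈ J, ∀ y ∈ J, x * y * x⁻¹ * y⁻¹ ∈ M

/-- The `π`-parts of the middle terms of a diamond inside an abelian section become
operator-isomorphic `π`-sections modulo the normal closure `N` of `hallJoin πᶜ M`. If these sections
coincide, then the `π`-parts are trivial, because `N M / M` is a `π'`-group. -/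
theorem IsAbelianDiamond.mem_of_pow_mem [Finite G] (hG : IsPiSeparable π G)
    (hcond : ∀ (R : Subgroup G) [R.Normal] (K H L : Subgroup (G ⧸ R)), HallPerm π K →
      HallPerm π H → HallPerm π L → IsPiGroup π K → IsPiGroup π H → IsPiGroup π L →
      AreOperatorIsomorphic (piResidual π (G ⧸ R)) H L K → H = L)
    {A B C M J : Subgroup G} (d : IsAbelianDiamond A B C M J) (hA : HallPerm π A)
    (hB : HallPerm π B) (hC : HallPerm π C) (hM : HallPerm π M) {a : G} (ha : a ∈ A) {n : ℕ}
    (hn : IsPiNumber π n) (han : a ^ n ∈ M) : a ∈ M := by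
  have hH := hG.hasHall
  obtain ⟨⟨P, hP⟩, Q, hQ⟩ := hG.hasHall
  have hMJ : M ≤ J := d.bot_le₁.trans d.le_top₁
  have hJM : J ≤ Subgroup.normalizer (M : Set G) :=
    le_normalizer_of_commutator_mem d.commutator_mem le_rfl hMJ
  set N := Subgroup.normalClosure (hallJoin πᶜ M : Set G)
  set f := QuotientGroup.mk' N
  have hs : Function.Surjective f := QuotientGroup.mk'_surjective N
  have hfN : ∀ x y, f x = f y ↔ x⁻¹ * y ∈ N := fun x y => QuotientGroup.eq
  have hMN : M ⊓ Q ≤ N := (inf_le_hallJoin M hQ).trans Subgroup.subset_normalClosure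
  have hNQ : N ≤ M ⊔ Q := hM.normalClosure_le hH hQ
  have hNJ : ∀ y ∈ J, y ∈ N → ∀ n, IsPiNumber π n → y ^ n ∈ M → y ∈ M := by
    intro y hyJ hyN n hn hyn
    refine mem_of_pow_mem_of_coprime (hn.coprime ?_) hyn
      (pow_relIndex_mem (Z := J ⊓ (M ⊔ Q)) (inf_le_left.trans hJM) ⟨hyJ, hNQ hyN⟩)
    have h1 : M.relIndex (J ⊓ (M ⊔ Q)) ∣ M.relIndex (Q ⊔ M) := by
      rw [← Subgroup.relIndex_mul_relIndex M (J ⊓ (M ⊔ Q)) (Q ⊔ M) (le_inf hMJ le_sup_left)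
        (by rw [sup_comm]; exact inf_le_right)]
      exact dvd_mul_right _ _
    rw [(hM.2 Q hQ).symm.relIndex_sup] at h1
    exact IsPiNumber.of_dvd hQ.1 (h1.trans (Subgroup.relIndex_dvd_card _ _))
  have hmem : ∀ {X : Subgroup G}, HallPerm π X → M ≤ X → X ≤ J → ∀ {x}, x ∈ M ⊔ (X ⊓ P) ↔
      x ∈ X ∧ ∃ n, IsPiNumber π n ∧ x ^ n ∈ M := fun hX hMX hXJ x =>
    hX.mem_sup_inf_hall_iff hMX
      (fun x hx y hy => d.commutator_mem x (hXJ hx) y (hXJ hy)) hP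
  have hperm : ∀ {X : Subgroup G}, HallPerm π X → M ≤ X → X ≤ J →
      HallPerm π (M ⊔ (X ⊓ P)) := fun hX hMX hXJ =>
    hX.sup_inf_hall hM hMX (fun x hx y hy => d.commutator_mem x (hXJ hx) y (hXJ hy)) hP
  have hpi : ∀ X : Subgroup G, X ≤ J → IsPiGroup π ((M ⊔ (X ⊓ P)).map f) := by
    intro X hX
    have hker : f.ker = N := QuotientGroup.ker_mk' N
    unfold IsPiGroup
    rw [← Subgroup.relIndex_ker, hker]
    refine IsPiNumber.of_dvd ?_ (Subgroup.relIndex_dvd_of_le_left _ hMN)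
    rw [← Subgroup.relIndex_mul_relIndex (M ⊓ Q) M _ inf_le_left le_sup_left]
    refine IsPiNumber.mul ?_ ?_
    · rw [Subgroup.inf_relIndex_left]
      simpa using (hM.2 Q hQ).relIndex_hall hQ
    · have h1 : Permutes M (X ⊓ P) :=
        permutes_of_le_normalizer ((inf_le_left.trans hX).trans hJM)
      rw [sup_comm, h1.symm.relIndex_sup]
      exact IsPiNumber.of_dvd hP.1 ((Subgroup.relIndex_dvd_card _ _).trans
        (Subgroup.card_dvd_of_le inf_le_right))
  have hpiM : IsPiGroup π (M.map f) := by
    have := hpi M hMJ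
    rwa [sup_eq_left.mpr (inf_le_left : M ⊓ P ≤ M)] at this
  -- Elements of two of the `π`-parts that agree modulo `N` agree modulo `M`.
  have hsep : ∀ {X Y : Subgroup G}, HallPerm π X → HallPerm π Y → M ≤ X → M ≤ Y → X ≤ J → Y ≤ J →
      X ⊓ Y ≤ M → ∀ x ∈ M ⊔ (X ⊓ P), ∀ y ∈ M ⊔ (Y ⊓ P), f x = f y → x ∈ M := by
    intro X Y hX hY hMX hMY hXJ hYJ hXY x hx y hy hxy
    obtain ⟨hx, m, hm, hxm⟩ := (hmem hX hMX hXJ).mp hx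
    obtain ⟨hy, k, hk, hyk⟩ := (hmem hY hMY hYJ).mp hy
    have h1 : x⁻¹ * y ∈ M := by
      refine hNJ _ (mul_mem (inv_mem (hXJ hx)) (hYJ hy)) ((hfN x y).mp hxy) (m * k) (hm.mul hk) ?_
      rw [mul_pow_mem_iff d.commutator_mem (inv_mem (hXJ hx)) (hYJ hy)]
      refine mul_mem ?_ ?_
      · rw [inv_pow, pow_mul]
        exact inv_mem (pow_mem hxm k)
      · rw [mul_comm m k, pow_mul]
        exact pow_mem hyk m
    refine hXY ⟨hx, ?_⟩
    have h2 := mul_mem hy (inv_mem (hMY h1))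
    simpa using h2
  have hinf : ∀ {X Y : Subgroup G}, HallPerm π X → HallPerm π Y → M ≤ X → M ≤ Y → X ≤ J → Y ≤ J →
      X ⊓ Y ≤ M → (M ⊔ (X ⊓ P)).map f ⊓ (M ⊔ (Y ⊓ P)).map f ≤ M.map f := by
    rintro X Y hX hY hMX hMY hXJ hYJ hXY _ ⟨⟨x, hx, rfl⟩, y, hy, hyx⟩
    exact ⟨x, hsep hX hY hMX hMY hXJ hYJ hXY x hx y hy hyx.symm, rfl⟩
  have hsup : ∀ {X Y Z : Subgroup G}, HallPerm π X → HallPerm π Y → HallPerm π Z → M ≤ X →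
      M ≤ Y → M ≤ Z → X ≤ J → Y ≤ J → Z ≤ J → Y ⊓ Z ≤ M → X ≤ Y ⊔ Z →
      (M ⊔ (X ⊓ P)).map f ≤ (M ⊔ (Y ⊓ P)).map f ⊔ (M ⊔ (Z ⊓ P)).map f := by
    intro X Y Z hX hY hZ hMX hMY hMZ hXJ hYJ hZJ hYZ hXYZ
    rw [← Subgroup.map_sup]
    refine Subgroup.map_mono fun x hx => ?_
    obtain ⟨hx, m, hm, hxm⟩ := (hmem hX hMX hXJ).mp hx
    have h1 : Permutes Y Z := permutes_of_le_normalizer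
      (hZJ.trans (le_normalizer_of_commutator_mem d.commutator_mem hMY hYJ))
    obtain ⟨y, hy, z, hz, rfl⟩ := h1.mem_sup.mp (hXYZ hx)
    rw [mul_pow_mem_iff d.commutator_mem (hYJ hy) (hZJ hz)] at hxm
    have h2 : y ^ m ∈ M := by
      refine hYZ ⟨pow_mem hy m, ?_⟩
      simpa using mul_mem (hMZ hxm) (inv_mem (pow_mem hz m))
    have h3 : z ^ m ∈ M := by simpa using mul_mem (inv_mem h2) hxm
    exact mul_mem (Subgroup.mem_sup_left ((hmem hY hMY hYJ).mpr ⟨hy, m, hm, h2⟩))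
      (Subgroup.mem_sup_right ((hmem hZ hMZ hZJ).mpr ⟨hz, m, hm, h3⟩))
  have hnorm : ∀ {X Y : Subgroup G}, X ≤ J → Y ≤ J → (M ⊔ (X ⊓ P)).map f ≤
      Subgroup.normalizer (((M ⊔ (Y ⊓ P)).map f : Subgroup (G ⧸ N)) : Set (G ⧸ N)) := by
    intro X Y hX hY
    have hYJ : M ⊔ (Y ⊓ P) ≤ J := sup_le hMJ (inf_le_left.trans hY)
    have hXJ : M ⊔ (X ⊓ P) ≤ J := sup_le hMJ (inf_le_left.trans hX)
    refine le_normalizer_of_forall ?_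
    rintro _ ⟨x, hx, rfl⟩ _ ⟨y, hy, rfl⟩
    exact ⟨x * y * x⁻¹, conj_mem_of_le_normalizer
      (le_normalizer_of_commutator_mem d.commutator_mem le_sup_left hYJ) (hXJ hx) hy, by simp⟩
  have hnormM : ∀ {X : Subgroup G}, X ≤ J → (M ⊔ (X ⊓ P)).map f ≤
      Subgroup.normalizer ((M.map f : Subgroup (G ⧸ N)) : Set (G ⧸ N)) := by
    intro X hX
    have := hnorm hX hMJ
    rwa [sup_eq_left.mpr (inf_le_left : M ⊓ P ≤ M)] at this
  have hHQ := hH.quotient N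
  have hA' := (hperm hA d.bot_le₁ d.le_top₁).map hG (R := N)
  have hB' := (hperm hB d.bot_le₂ d.le_top₂).map hG (R := N)
  have hC' := (hperm hC d.bot_le₃ d.le_top₃).map hG (R := N)
  have hM' := hM.map hG (R := N)
  have heq := hcond N (M.map f) ((M ⊔ (A ⊓ P)).map f) ((M ⊔ (B ⊓ P)).map f) hM' hA' hB' hpiM
    (hpi A d.le_top₁) (hpi B d.le_top₂)
    (areOperatorIsomorphic_of_perspective (E := (M ⊔ (C ⊓ P)).map f)
      (Subgroup.map_mono le_sup_left) (Subgroup.map_mono le_sup_left)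
      (Subgroup.map_mono le_sup_left) (hnormM d.le_top₁) (hnormM d.le_top₂)
      (hnorm d.le_top₁ d.le_top₃)
      (hM'.piResidual_le_normalizer hHQ hpiM)
      (hA'.piResidual_le_normalizer hHQ (hpi A d.le_top₁))
      (hB'.piResidual_le_normalizer hHQ (hpi B d.le_top₂))
      (hC'.piResidual_le_normalizer hHQ (hpi C d.le_top₃))
      (hinf hA hC d.bot_le₁ d.bot_le₃ d.le_top₁ d.le_top₃ d.inf_le₁₃)
      (hinf hB hC d.bot_le₂ d.bot_le₃ d.le_top₂ d.le_top₃ d.inf_le₂₃)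
      (hsup hA hB hC d.bot_le₁ d.bot_le₂ d.bot_le₃ d.le_top₁ d.le_top₂ d.le_top₃ d.inf_le₂₃
        d.le_sup₁)
      (hsup hB hA hC d.bot_le₂ d.bot_le₁ d.bot_le₃ d.le_top₂ d.le_top₁ d.le_top₃ d.inf_le₁₃
        d.le_sup₂))
  have haA : a ∈ M ⊔ (A ⊓ P) := (hmem hA d.bot_le₁ d.le_top₁).mpr ⟨ha, n, hn, han⟩
  have hfa : f a ∈ (M ⊔ (B ⊓ P)).map f := heq ▸ Subgroup.mem_map_of_mem f haA
  obtain ⟨b, hb, hba⟩ := hfa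
  exact hsep hA hB d.bot_le₁ d.bot_le₂ d.le_top₁ d.le_top₂ d.inf_le₁₂ a haA b hb hba.symm

/-! ### Modular lattices without diamonds -/

/-- A modular lattice without diamonds is distributive. For elements `a`, `b`, `c` with lower and
upper median `m` and `j`, the elements `(a ⊔ m) ⊓ j`, `(b ⊔ m) ⊓ j`, `(c ⊔ m) ⊓ j` have pairwise meet
`m` and pairwise join `j`. -/
theorem isDistributive_of_forall_diamond {α : Type*} [Lattice α] [IsModularLattice α]
    (h : ∀ a b c m j : α, a ⊓ b = m → a ⊓ c = m → b ⊓ c = m → a ⊔ b = j → a ⊔ c = j →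
      b ⊔ c = j → a ≤ m) : IsDistributive α := by
  intro a b c
  refine le_antisymm ?_ (sup_le (inf_le_inf_left a le_sup_left) (inf_le_inf_left a le_sup_right))
  have hinf : ∀ x y z : α, (x ⊔ (y ⊓ z)) ⊓ (y ⊔ (z ⊓ x)) = (x ⊓ y) ⊔ (y ⊓ z) ⊔ (z ⊓ x) := by
    intro x y z
    have h1 : y ⊓ z ≤ y ⊔ (z ⊓ x) := inf_le_left.trans le_sup_left
    have h2 : z ⊓ x ≤ x := inf_le_right
    rw [sup_comm x, sup_inf_assoc_of_le x h1, sup_comm y, inf_comm x, sup_inf_assoc_of_le y h2,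
      inf_comm y x]
    ac_rfl
  have hsup : ∀ x y z : α, (x ⊓ (y ⊔ z)) ⊔ (y ⊓ (z ⊔ x)) = (x ⊔ y) ⊓ (y ⊔ z) ⊓ (z ⊔ x) := by
    intro x y z
    have h1 : y ⊓ (z ⊔ x) ≤ y ⊔ z := inf_le_left.trans le_sup_left
    have h2 : x ≤ z ⊔ x := le_sup_right
    rw [inf_comm x, inf_sup_assoc_of_le x h1, inf_comm y, sup_comm x, inf_sup_assoc_of_le y h2,
      sup_comm y x]
    ac_rfl
  have hmid : ∀ x y z : α, (x ⊔ (y ⊓ z)) ⊓ ((x ⊔ y) ⊓ (y ⊔ z) ⊓ (z ⊔ x)) =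
      (x ⊓ (y ⊔ z)) ⊔ ((x ⊓ y) ⊔ (y ⊓ z) ⊔ (z ⊓ x)) := by
    intro x y z
    have h1 : x ⊔ (y ⊓ z) ≤ (x ⊔ y) ⊓ (z ⊔ x) :=
      le_inf (sup_le_sup_left inf_le_left x) (sup_le le_sup_right (inf_le_right.trans le_sup_left))
    have h2 : (x ⊓ y) ⊔ (z ⊓ x) ≤ x ⊓ (y ⊔ z) :=
      sup_le (inf_le_inf_left x le_sup_left) (le_inf inf_le_right (inf_le_left.trans le_sup_right))
    have h3 : y ⊓ z ≤ y ⊔ z := inf_le_left.trans le_sup_left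
    calc (x ⊔ (y ⊓ z)) ⊓ ((x ⊔ y) ⊓ (y ⊔ z) ⊓ (z ⊔ x))
        = ((x ⊔ (y ⊓ z)) ⊓ ((x ⊔ y) ⊓ (z ⊔ x))) ⊓ (y ⊔ z) := by ac_rfl
      _ = ((y ⊓ z) ⊔ x) ⊓ (y ⊔ z) := by rw [inf_eq_left.mpr h1, sup_comm x]
      _ = (y ⊓ z) ⊔ (x ⊓ (y ⊔ z)) := sup_inf_assoc_of_le x h3
      _ = (y ⊓ z) ⊔ ((x ⊓ (y ⊔ z)) ⊔ ((x ⊓ y) ⊔ (z ⊓ x))) := by rw [sup_eq_left.mpr h2]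
      _ = (x ⊓ (y ⊔ z)) ⊔ ((x ⊓ y) ⊔ (y ⊓ z) ⊔ (z ⊓ x)) := by ac_rfl
  set m := (a ⊓ b) ⊔ (b ⊓ c) ⊔ (c ⊓ a) with hm
  set j := (a ⊔ b) ⊓ (b ⊔ c) ⊓ (c ⊔ a) with hj
  have hmj : m ≤ j := by
    refine le_inf (le_inf ?_ ?_) ?_
    · exact sup_le (sup_le (inf_le_left.trans le_sup_left) (inf_le_left.trans le_sup_right))
        (inf_le_right.trans le_sup_left)
    · exact sup_le (sup_le (inf_le_right.trans le_sup_left) (inf_le_left.trans le_sup_left))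
        (inf_le_left.trans le_sup_right)
    · exact sup_le (sup_le (inf_le_left.trans le_sup_right) (inf_le_right.trans le_sup_left))
        (inf_le_left.trans le_sup_left)
  have m1 : (b ⊓ c) ⊔ (c ⊓ a) ⊔ (a ⊓ b) = m := by rw [hm]; ac_rfl
  have m2 : (c ⊓ a) ⊔ (a ⊓ b) ⊔ (b ⊓ c) = m := by rw [hm]; ac_rfl
  have j1 : (b ⊔ c) ⊓ (c ⊔ a) ⊓ (a ⊔ b) = j := by rw [hj]; ac_rfl
  have j2 : (c ⊔ a) ⊓ (a ⊔ b) ⊓ (b ⊔ c) = j := by rw [hj]; ac_rfl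
  have meet : ∀ x y : α, x ⊓ y = m → (x ⊓ j) ⊓ (y ⊓ j) = m := fun x y e => by
    rw [← inf_inf_distrib_right, e, inf_eq_left.mpr hmj]
  have join : ∀ x y : α, x ⊔ y = j → (x ⊔ m) ⊔ (y ⊔ m) = j := fun x y e => by
    rw [← sup_sup_distrib_right, e, sup_eq_left.mpr hmj]
  have ea := hmid a b c
  have eb := hmid b c a
  have ec := hmid c a b
  rw [← hm, ← hj] at ea
  rw [m1, j1] at eb
  rw [m2, j2] at ec
  have i1 := meet _ _ (hinf a b c)
  have i2 := meet _ _ ((hinf b c a).trans m1)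
  have i3 := meet _ _ ((hinf c a b).trans m2)
  have s1 := join _ _ (hsup a b c)
  have s2 := join _ _ ((hsup b c a).trans j1)
  have s3 := join _ _ ((hsup c a b).trans j2)
  rw [← ea, ← eb] at s1
  rw [← eb, ← ec] at s2
  rw [← ec, ← ea] at s3
  have k1 := h _ _ _ m j i1 (by rw [inf_comm]; exact i3) i2 s1 (by rw [sup_comm]; exact s3) s2
  rw [ea] at k1
  have k2 : a ⊓ (b ⊔ c) ≤ a ⊓ m := le_inf inf_le_left (le_sup_left.trans k1)
  have h2 : (a ⊓ b) ⊔ (c ⊓ a) ≤ a := sup_le inf_le_left inf_le_right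
  refine k2.trans ?_
  have h3 : m = ((a ⊓ b) ⊔ (c ⊓ a)) ⊔ (b ⊓ c) := by rw [hm]; ac_rfl
  rw [h3, inf_comm, sup_inf_assoc_of_le _ h2, inf_comm c a]
  refine sup_le le_rfl (le_sup_of_le_left (le_inf inf_le_right (inf_le_left.trans inf_le_left)))

/-! ### Diamonds collapse -/

theorem commutator_mem_of_mem_sup {J M S T : Subgroup G}
    (hM : J ≤ Subgroup.normalizer (M : Set G)) (hS : S ≤ J) (hST : Permutes S T) {x : G}
    (h1 : ∀ s ∈ S, x * s * x⁻¹ * s⁻¹ ∈ M) (h2 : ∀ t ∈ T, x * t * x⁻¹ * t⁻¹ ∈ M) :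
    ∀ y ∈ S ⊔ T, x * y * x⁻¹ * y⁻¹ ∈ M := by
  intro y hy
  obtain ⟨s, hs, t, ht, rfl⟩ := hST.mem_sup.mp hy
  have := mul_mem (h1 s hs) (conj_mem_of_le_normalizer hM (hS hs) (h2 t ht))
  convert this using 1
  group

/-- The section between the bottom and the top of a diamond of normal subgroups is abelian. -/
theorem isAbelianDiamond_of_le_normalizer {A B C M J : Subgroup G} (h12 : A ⊓ B = M)
    (h13 : A ⊓ C = M) (h23 : B ⊓ C = M) (s12 : A ⊔ B = J) (s13 : A ⊔ C = J) (s23 : B ⊔ C = J)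
    (hA : J ≤ Subgroup.normalizer (A : Set G)) (hB : J ≤ Subgroup.normalizer (B : Set G))
    (hC : J ≤ Subgroup.normalizer (C : Set G)) : IsAbelianDiamond A B C M J := by
  have hMJ : J ≤ Subgroup.normalizer (M : Set G) := h12 ▸ le_normalizer_inf hA hB
  have hAJ : A ≤ J := s12 ▸ le_sup_left
  have hBJ : B ≤ J := s12 ▸ le_sup_right
  have hCJ : C ≤ J := s13 ▸ le_sup_right
  have key : ∀ {X Y : Subgroup G}, X ≤ J → Y ≤ J → J ≤ Subgroup.normalizer (X : Set G) →
      J ≤ Subgroup.normalizer (Y : Set G) → X ⊓ Y = M →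
      ∀ x ∈ X, ∀ y ∈ Y, x * y * x⁻¹ * y⁻¹ ∈ M := by
    intro X Y hXJ hYJ hX hY hXY x hx y hy
    rw [← hXY]
    refine ⟨?_, Y.mul_mem (conj_mem_of_le_normalizer hY (hXJ hx) hy) (Y.inv_mem hy)⟩
    have := X.mul_mem hx (conj_mem_of_le_normalizer hX (hYJ hy) (X.inv_mem hx))
    simpa [mul_assoc] using this
  have perm : ∀ {X Y : Subgroup G}, Y ≤ J → J ≤ Subgroup.normalizer (X : Set G) → Permutes X Y :=
    fun hY hX => permutes_of_le_normalizer (hY.trans hX)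
  have hAc : ∀ x ∈ A, ∀ y ∈ J, x * y * x⁻¹ * y⁻¹ ∈ M := by
    intro x hx
    rw [← s23]
    exact commutator_mem_of_mem_sup hMJ hBJ (perm hCJ hB) (key hAJ hBJ hA hB h12 x hx)
      (key hAJ hCJ hA hC h13 x hx)
  have hBc : ∀ x ∈ B, ∀ y ∈ J, x * y * x⁻¹ * y⁻¹ ∈ M := by
    intro x hx
    rw [← s13]
    exact commutator_mem_of_mem_sup hMJ hAJ (perm hCJ hA)
      (key hBJ hAJ hB hA (by rwa [inf_comm]) x hx) (key hBJ hCJ hB hC h23 x hx)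
  have swap : ∀ x y : G, x * y * x⁻¹ * y⁻¹ ∈ M → y * x * y⁻¹ * x⁻¹ ∈ M := fun x y h => by
    have := inv_mem h
    simpa [mul_assoc] using this
  refine ⟨h12 ▸ inf_le_left, h12 ▸ inf_le_right, h13 ▸ inf_le_right, hAJ, hBJ, hCJ, h12.le, h13.le,
    h23.le, s23 ▸ hAJ, s13 ▸ hBJ, fun x hx => ?_⟩
  rw [← s12]
  exact commutator_mem_of_mem_sup hMJ hAJ (perm hBJ hA)
    (fun y hy => swap y x (hAc y hy x hx)) (fun y hy => swap y x (hBc y hy x hx))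

theorem IsomorphicSectionsCoincide.of_hallPerm [Finite G] (hG : IsPiSeparable π G)
    {τ : Set Nat.Primes} (hτ : ∀ (R : Subgroup G) [R.Normal] {A : Subgroup (G ⧸ R)},
      HallPerm τ A → HallPerm π A)
    (h : IsomorphicSectionsCoincide (sigmaPi π) τ G) (R : Subgroup G) [R.Normal]
    (K H L : Subgroup (G ⧸ R)) (hK : HallPerm τ K) (hH : HallPerm τ H) (hL : HallPerm τ L)
    (hK' : IsPiGroup τ K) (hH' : IsPiGroup τ H) (hL' : IsPiGroup τ L)
    (e : AreOperatorIsomorphic (piResidual τ (G ⧸ R)) H L K) : H = L :=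
  have hG' := hG.hasHall.quotient R
  h R K H L ((isSigmaPermutable_iff hG').mpr (hτ R hK)) ((isSigmaPermutable_iff hG').mpr (hτ R hH))
    ((isSigmaPermutable_iff hG').mpr (hτ R hL)) hK' hH' hL' e

/-- If `A / M` has neither elements of `π`-order nor elements of `π'`-order, it is trivial. -/
theorem IsAbelianDiamond.le_bot [Finite G] (hG : IsPiSeparable π G)
    (h2 : IsomorphicSectionsCoincide (sigmaPi π) π G)
    (h3 : IsomorphicSectionsCoincide (sigmaPi π) πᶜ G) {A B C M J : Subgroup G}
    (d : IsAbelianDiamond A B C M J) (hA : HallPerm π A) (hB : HallPerm π B) (hC : HallPerm π C)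
    (hM : HallPerm π M) : A ≤ M := by
  intro a ha
  obtain ⟨P, hP⟩ := hG.exists_hall
  refine d.mem_of_pow_mem hG (h2.of_hallPerm hG fun _ _ _ h => h) hA hB hC hM ha hP.1 ?_
  refine d.mem_of_pow_mem hG.compl (h3.of_hallPerm hG fun _ _ _ => hallPerm_compl_iff.mp)
    hA.compl hB.compl hC.compl hM.compl (pow_mem ha _) hP.2 ?_
  rw [← pow_mul, Subgroup.card_mul_index, pow_card_eq_one']
  exact one_mem M

/-- A diamond with top `J` and bottom `M` such that `J ∩ O ≤ M`, where `G / O` is cyclic, collapses: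
its middle terms have the same order modulo `M`. -/
theorem le_of_inf_le [Finite G] {O : Subgroup G} [O.Normal] [IsCyclic (G ⧸ O)]
    {A B C M J : Subgroup G} (h12 : A ⊓ B ≤ M) (h13 : A ⊓ C ≤ M) (h23 : B ⊓ C ≤ M)
    (hMB : M ≤ B) (hMC : M ≤ C) (hAJ : A ≤ J) (hBJ : B ≤ J) (hCJ : C ≤ J)
    (hABC : A ≤ B ⊔ C) (hperm : Permutes B C) (hJO : J ⊓ O ≤ M) : A ≤ M := by
  have hc : ∀ x ∈ J, ∀ y ∈ J, x * y * x⁻¹ * y⁻¹ ∈ M := fun x hx y hy =>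
    hJO ⟨J.mul_mem (J.mul_mem (J.mul_mem hx hy) (J.inv_mem hx)) (J.inv_mem hy),
      commutator_mem_of_isCyclic x y⟩
  intro a ha
  obtain ⟨b, hb, c, hcC, rfl⟩ := hperm.mem_sup.mp (hABC ha)
  refine h12 ⟨ha, mem_of_isCyclic_quotient hJO (hAJ ha) (hBJ hb) (fun n => ?_) hMB hb⟩
  constructor
  · intro h
    rw [mul_pow_mem_iff hc (hBJ hb) (hCJ hcC)] at h
    refine h23 ⟨pow_mem hb n, ?_⟩
    simpa using mul_mem (hMC h) (inv_mem (pow_mem hcC n))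
  · intro h
    refine h13 ⟨pow_mem ha n, ?_⟩
    have h4 := (mul_pow_mem_iff (M := C) (fun x hx y hy => hMC (hc x hx y hy))
      (J.inv_mem (hBJ hb)) (hAJ ha) n).mp (by simpa using pow_mem hcC n)
    rw [inv_pow] at h4
    simpa using mul_mem (hMC h) h4

/-! ### The lattice of `σ^π`-permutable subgroups -/

theorem joinSplits_of_isDistributive [Finite G] (hG : HasHall π G)
    (h : IsDistributive (SigmaPermSubgroups (sigmaPi π) G)) : JoinSplits (HallPerm π (G := G)) := by
  intro A B C hA hB hC hABC
  let A' : SigmaPermSubgroups (sigmaPi π) G := ⟨A, (isSigmaPermutable_iff hG).mpr hA⟩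
  let B' : SigmaPermSubgroups (sigmaPi π) G := ⟨B, (isSigmaPermutable_iff hG).mpr hB⟩
  let C' : SigmaPermSubgroups (sigmaPi π) G := ⟨C, (isSigmaPermutable_iff hG).mpr hC⟩
  have h1 : A' ≤ A' ⊓ (B' ⊔ C') := le_inf le_rfl hABC
  rw [h A' B' C'] at h1
  have hinf : ∀ X Y : SigmaPermSubgroups (sigmaPi π) G, (X ⊓ Y).1 ≤ X.1 ⊓ Y.1 := fun X Y =>
    le_inf (inf_le_left : X ⊓ Y ≤ X) (inf_le_right : X ⊓ Y ≤ Y)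
  have h2 : A ≤ (A' ⊓ B').1 ⊔ (A' ⊓ C').1 := h1
  exact h2.trans (sup_le_sup (hinf A' B') (hinf A' C'))

/-- The meet of permuting members is their intersection. -/
theorem coe_inf_of_permutes [Finite G] (hG : HasHall π G)
    {A B : SigmaPermSubgroups (sigmaPi π) G} (h : Permutes A.1 B.1) :
    (A ⊓ B).1 = A.1 ⊓ B.1 := by
  have hA := (isSigmaPermutable_iff hG).mp A.2
  have hB := (isSigmaPermutable_iff hG).mp B.2
  refine le_antisymm (le_inf (inf_le_left : A ⊓ B ≤ A) (inf_le_right : A ⊓ B ≤ B)) ?_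
  let X : SigmaPermSubgroups (sigmaPi π) G :=
    ⟨A.1 ⊓ B.1, (isSigmaPermutable_iff hG).mpr (hA.inf_of_permutes hB h)⟩
  exact (le_inf (inf_le_left : A.1 ⊓ B.1 ≤ A.1) (inf_le_right : A.1 ⊓ B.1 ≤ B.1) : X ≤ A ⊓ B)

theorem isModularLattice_of_permutes [Finite G] (hG : HasHall π G)
    (h : ∀ A B : SigmaPermSubgroups (sigmaPi π) G, Permutes A.1 B.1) :
    IsModularLattice (SigmaPermSubgroups (sigmaPi π) G) where
  sup_inf_le_assoc_of_le {x} y {z} hxz := by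
    change ((x ⊔ y) ⊓ z).1 ≤ x.1 ⊔ (y ⊓ z).1
    rw [coe_inf_of_permutes hG (h _ _), coe_inf_of_permutes hG (h _ _)]
    rintro g ⟨hg, hgz⟩
    obtain ⟨a, ha, b, hb, rfl⟩ := (h x y).mem_sup.mp hg
    refine mul_mem (Subgroup.mem_sup_left ha) (Subgroup.mem_sup_right ⟨hb, ?_⟩)
    simpa using mul_mem (inv_mem ((hxz : x.1 ≤ z.1) ha)) hgz

/-- Diamonds collapse in two steps: by meet-distributivity of `D`, a diamond cuts out another one
below `D`, where all members of the lattice are normal in `D`; once this one has collapsed, the given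
diamond lives in a cyclic section. -/
theorem isDistributive_of_sections [Finite G] (hG : IsPiSeparable π G)
    (hperm : ∀ A B : SigmaPermSubgroups (sigmaPi π) G, Permutes A.1 B.1)
    (hcyc : IsCyclic (G ⧸ piDecomposableResidual π G)) (d : SigmaPermSubgroups (sigmaPi π) G)
    (hd : d.1 = piDecomposableResidual π G) (hdist : IsMeetDistributive d)
    (h2 : IsomorphicSectionsCoincide (sigmaPi π) π G)
    (h3 : IsomorphicSectionsCoincide (sigmaPi π) πᶜ G) :
    IsDistributive (SigmaPermSubgroups (sigmaPi π) G) := by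
  have hH := hG.hasHall
  have := isModularLattice_of_permutes hH hperm
  have hp : ∀ X : SigmaPermSubgroups (sigmaPi π) G, HallPerm π X.1 := fun X =>
    (isSigmaPermutable_iff hH).mp X.2
  have hinf : ∀ X Y : SigmaPermSubgroups (sigmaPi π) G, (X ⊓ Y).1 = X.1 ⊓ Y.1 := fun X Y =>
    coe_inf_of_permutes hH (hperm X Y)
  refine isDistributive_of_forall_diamond fun a b c m j h12 h13 h23 s12 s13 s23 => ?_
  have i12 : (d ⊓ a).1 ⊓ (d ⊓ b).1 = (d ⊓ m).1 := by
    rw [← hinf, ← inf_inf_distrib_left, h12]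
  have i13 : (d ⊓ a).1 ⊓ (d ⊓ c).1 = (d ⊓ m).1 := by
    rw [← hinf, ← inf_inf_distrib_left, h13]
  have i23 : (d ⊓ b).1 ⊓ (d ⊓ c).1 = (d ⊓ m).1 := by
    rw [← hinf, ← inf_inf_distrib_left, h23]
  have t12 : (d ⊓ a).1 ⊔ (d ⊓ b).1 = (d ⊓ j).1 := by
    rw [← s12, hdist a b]; rfl
  have t13 : (d ⊓ a).1 ⊔ (d ⊓ c).1 = (d ⊓ j).1 := by
    rw [← s13, hdist a c]; rfl
  have t23 : (d ⊓ b).1 ⊔ (d ⊓ c).1 = (d ⊓ j).1 := by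
    rw [← s23, hdist b c]; rfl
  have hnorm : ∀ X : SigmaPermSubgroups (sigmaPi π) G,
      (d ⊓ j).1 ≤ Subgroup.normalizer (X.1 : Set G) := fun X =>
    (show (d ⊓ j).1 ≤ d.1 from (inf_le_left : d ⊓ j ≤ d)).trans
      (hd.le.trans ((hp X).residual_le_normalizer hH))
  have key := (isAbelianDiamond_of_le_normalizer i12 i13 i23 t12 t13 t23 (hnorm _) (hnorm _)
    (hnorm _)).le_bot hG h2 h3 (hp _) (hp _) (hp _) (hp _)
  have hjm : d ⊓ j ≤ m := by
    have e1 : (d ⊓ j).1 ≤ (d ⊓ b).1 :=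
      t12 ▸ sup_le (key.trans (i12 ▸ inf_le_right)) le_rfl
    have e2 : (d ⊓ j).1 ≤ (d ⊓ c).1 :=
      t13 ▸ sup_le (key.trans (i13 ▸ inf_le_right)) le_rfl
    have e3 : (d ⊓ j).1 ≤ (d ⊓ m).1 := i23 ▸ le_inf e1 e2
    exact e3.trans (inf_le_right : d ⊓ m ≤ m)
  have hJO : j.1 ⊓ piDecomposableResidual π G ≤ m.1 := by
    rw [← hd, inf_comm, ← hinf]
    exact hjm
  exact le_of_inf_le (C := c.1) (by rw [← hinf, h12]) (by rw [← hinf, h13]) (by rw [← hinf, h23])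
    (h12 ▸ inf_le_right : m ≤ b) (h13 ▸ inf_le_right : m ≤ c)
    (s12 ▸ le_sup_left : a ≤ j) (s12 ▸ le_sup_right : b ≤ j) (s13 ▸ le_sup_right : c ≤ j)
    ((s12 ▸ le_sup_left : a ≤ j).trans s23.ge : a ≤ b ⊔ c) (hperm b c) hJO

theorem isDistributive_normalSubgroups (W : JoinSplits (HallPerm π (G := G))) :
    IsDistributive (NormalSubgroups G) := by
  rintro ⟨A, hA⟩ ⟨B, hB⟩ ⟨C, hC⟩
  apply le_antisymm
  · change A ⊓ (B ⊔ C) ≤ (A ⊓ B) ⊔ (A ⊓ C)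
    refine (W (A ⊓ (B ⊔ C)) B C (.of_normal _) (.of_normal B) (.of_normal C) inf_le_right).trans ?_
    exact sup_le_sup (inf_le_inf_right B inf_le_left) (inf_le_inf_right C inf_le_left)
  · exact sup_le (inf_le_inf_left _ le_sup_left) (inf_le_inf_left _ le_sup_right)

end SigmaPerm

theorem corollary1p5 (π : Set Nat.Primes) (G : Type*) [Group G] [Finite G]
    (hG : SigmaPerm.IsPiSeparable π G) :
    SigmaPerm.IsDistributive (SigmaPerm.SigmaPermSubgroups (SigmaPerm.sigmaPi π) G) ↔
      ((∀ A B : SigmaPerm.SigmaPermSubgroups (SigmaPerm.sigmaPi π) G,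
            SigmaPerm.Permutes A.1 B.1) ∧
        SigmaPerm.IsDistributive (SigmaPerm.NormalSubgroups G) ∧
        (IsCyclic (G ⧸ SigmaPerm.piDecomposableResidual π G) ∧
          ∃ d : SigmaPerm.SigmaPermSubgroups (SigmaPerm.sigmaPi π) G,
            d.1 = SigmaPerm.piDecomposableResidual π G ∧ SigmaPerm.IsMeetDistributive d)) ∧
      SigmaPerm.IsomorphicSectionsCoincide (SigmaPerm.sigmaPi π) π G ∧
      SigmaPerm.IsomorphicSectionsCoincide (SigmaPerm.sigmaPi π) πᶜ G := by
  have hH := hG.hasHall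
  constructor
  · intro h
    have W := SigmaPerm.joinSplits_of_isDistributive hH h
    refine ⟨⟨fun A B => ?_, SigmaPerm.isDistributive_normalSubgroups W,
      SigmaPerm.isCyclic_quotient_residual hH W, ?_⟩,
      SigmaPerm.isomorphicSectionsCoincide_of_joinSplits hG W⟩
    · exact SigmaPerm.permutes_of_joinSplits hH W ((SigmaPerm.isSigmaPermutable_iff hH).mp A.2)
        ((SigmaPerm.isSigmaPermutable_iff hH).mp B.2)
    · exact ⟨⟨SigmaPerm.piDecomposableResidual π G, (SigmaPerm.isSigmaPermutable_iff hH).mpr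
        (.of_normal (SigmaPerm.piDecomposableResidual π G))⟩, rfl, h _⟩
  · rintro ⟨⟨hperm, -, hcyc, d, hd, hdist⟩, h2, h3⟩
    exact SigmaPerm.isDistributive_of_sections hG hperm hcyc d hd hdist h2 h3
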